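/- Let $m\ge 4$ be an integer and let $G$ be a finite group. Let $V=G_1\cup\dots\cup G_m$ be the disjoint union of $m$ copies $G_i=\{x_i : x\in G\}$ of $G$. An $m$-PCayley digraph of $G$ is a digraph with vertex set $V$ and arc set $\bigcup_{1\le i,j\le m}\{(x_i,(sx)_j) : x\in G,\ s\in S_{i,j}\}$, for some subsets $S_{i,j}\subseteq G$ $(1\le i,j\le m)$ with $S_{i,i}=\emptyset$ for all $i$; it is called an $m$-PCayley graph if its arc set is symmetric. For $g\in G$ let $R(g)$ be the permutation $x_i\mapsto (xg)_i$ of $V$, let $R(G)=\{R(g): g\in G\}$, and let $N$ be the normalizer of $R(G)$ in the symmetric group on $V$. An $m$-PCayley (di)graph $\Gamma$ of $G$ is called $m$PCI if for every $m$-PCayley (di)graph $\Sigma$ of $G$ for which there is an isomorphism from $\Gamma$ to $\Sigma$ mapping each $G_i$ onto some $G_j$, there is $n\in N$ with $\Gamma^n=\Sigma$, where $\Gamma^n$ is the digraph on $V$ with arcs $(u^n,v^n)$ for the arcs $(u,v)$ of $\Gamma$. The group $G$ is called $m$PCI if every $m$-PCayley graph of $G$ is $m$PCI, and $m$PDCI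 if every $m$-PCayley digraph of $G$ is $m$PCI. Then: (1) $G$ is $m$PCI if and only if $G\cong\mathbb{Z}_1$, or $G\cong\mathbb{Z}_2$, or $m\in\{4,5\}$ and $G$ is isomorphic to $\mathbb{Z}_3$ or to the dihedral group $D_6$ of order $6$; (2) $G$ is $m$PDCI if and only if $G\cong\mathbb{Z}_1$ or $G\cong\mathbb{Z}_2$. -/

import Mathlib

namespace MCayley

variable {m : ℕ} {G : Type*} [Group G]

/-- The `m`-Cayley digraph `Cay(G, S i j)`: the vertex `(i, x)` is the element `x` of the
`i`-th copy of `G`, and the arcs are the pairs `((i, x), (j, s * x))` with `s ∈ S i j`. -/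
def cay (S : Fin m → Fin m → Set G) : Digraph (Fin m × G) where
  Adj u v := ∃ s ∈ S u.1 v.1, v.2 = s * u.2

/-- `Γ` is an `m`-PCayley digraph of `G`: an `m`-Cayley digraph with all `S i i` empty. -/
def IsPCayleyDigraph (Γ : Digraph (Fin m × G)) : Prop :=
  ∃ S : Fin m → Fin m → Set G, (∀ i, S i i = ∅) ∧ Γ = cay S

/-- A digraph is a graph if its arc set is symmetric. -/
def IsGraph {V : Type*} (Γ : Digraph V) : Prop :=
  ∀ u v, Γ.Adj u v → Γ.Adj v u

/-- `Γ` is an `m`-PCayley graph of `G`. -/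
def IsPCayleyGraph (Γ : Digraph (Fin m × G)) : Prop :=
  IsPCayleyDigraph Γ ∧ IsGraph Γ

/-- The image `Γ ^ σ` of a digraph under a permutation of its vertices: its arcs are the
pairs `(σ u, σ v)` with `(u, v)` an arc of `Γ`. -/
def image {V : Type*} (Γ : Digraph V) (σ : Equiv.Perm V) : Digraph V where
  Adj a b := ∃ u v, Γ.Adj u v ∧ σ u = a ∧ σ v = b

variable (m) in
/-- The right multiplication `(i, x) ↦ (i, x * g)`. -/
def rightMul (g : G) : Equiv.Perm (Fin m × G) :=
  Equiv.prodCongr (Equiv.refl (Fin m)) (Equiv.mulRight g)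

variable (m G) in
/-- The group `R(G)` of all right multiplications on `m` copies of `G`. -/
def rightMulGroup : Subgroup (Equiv.Perm (Fin m × G)) where
  carrier := Set.range (rightMul m)
  one_mem' := ⟨1, by ext x <;> simp [rightMul]⟩
  mul_mem' := by
    rintro _ _ ⟨g, rfl⟩ ⟨h, rfl⟩
    exact ⟨h * g, by ext x <;> simp [rightMul, mul_assoc]⟩
  inv_mem' := by
    rintro _ ⟨g, rfl⟩
    refine ⟨g⁻¹, eq_inv_of_mul_eq_one_left ?_⟩
    ext x <;> simp [rightMul]

variable (G) in
/-- The `i`-th copy `G_i` of `G` in the vertex set. -/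
def block (i : Fin m) : Set (Fin m × G) := {v | v.1 = i}

/-- `Γ` and `Δ` are `p`-isomorphic: there is an isomorphism from `Γ` to `Δ` that maps every
`G_i` onto some `G_j`. -/
def PIsomorphic (Γ Δ : Digraph (Fin m × G)) : Prop :=
  ∃ σ : Equiv.Perm (Fin m × G),
    (∀ u v, Γ.Adj u v ↔ Δ.Adj (σ u) (σ v)) ∧ ∀ i, ∃ j, σ '' block G i = block G j

/-- The `m`-PCayley digraph `Γ` is `m`PCI: each `m`-PCayley digraph of `G` that is
`p`-isomorphic to `Γ` is the image of `Γ` under an element of the normalizer of `R(G)` in the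
symmetric group on the vertices. If `Γ` is a graph, then so is every such digraph, so that
the same definition serves graphs. -/
def IsPCI (Γ : Digraph (Fin m × G)) : Prop :=
  ∀ Δ : Digraph (Fin m × G), IsPCayleyDigraph Δ → PIsomorphic Γ Δ →
    ∃ n ∈ Subgroup.normalizer (rightMulGroup m G : Set (Equiv.Perm (Fin m × G))),
      image Γ n = Δ

variable (m G) in
/-- `G` is an `m`PCI-group: every `m`-PCayley graph of `G` is `m`PCI. -/
def IsPCIGroup : Prop :=
  ∀ Γ : Digraph (Fin m × G), IsPCayleyGraph Γ → IsPCI Γ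

variable (m G) in
/-- `G` is an `m`PDCI-group: every `m`-PCayley digraph of `G` is `m`PCI. -/
def IsPDCIGroup : Prop :=
  ∀ Γ : Digraph (Fin m × G), IsPCayleyDigraph Γ → IsPCI Γ

end MCayley

namespace MCayley

variable {m : ℕ} {G : Type*} [Group G]

/-! ### Cayley digraphs and the normalizer of the right multiplications -/

/-! Necessity. Digraphs on few copies of a group `H` embedded in `G` can be padded to `m` copies of
`G`, and a relation by the normalizer descends to a permutation of the copies, an injective
endomorphism of `H` and translations (`exists_of_isPCI_padded`). So small counterexamples suffice.
On a square of four copies with two opposite sides labelled `A`, `A` in one graph and `A`, `B` in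
the other, the same endomorphism acts on both sides and cancels; a relation would make `B` a
translate of `A` (`not_isPCIGroup_of_square`). This excludes elements of order 4, of order 6 and of
odd order at least 5, and noncyclic subgroups of order `p ^ 2`. Hence the order of `G` divides 6 and
no element has order 6. For elements of order 3 the obstruction is orientation. Two rigid pieces,
each with a nontrivial voltage around a cycle, are joined by complete connections; inverting a
single piece is a p-isomorphism, but no automorphism inverts one voltage and fixes the other. Such a
piece needs three copies for graphs (so `6 ≤ m`) and two for digraphs.

Sufficiency. As in Babai's criterion, it is enough to move the `σ`-conjugate of `R(G)` to `R(G)` by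
automorphisms of `Γ` that fix each copy (`isPCI_of_forall_conjAut`). Copies of size at most two
leave nothing to do. For `ℤ₃` and `D₆`, Sylow's theorem gives the conjugate of `R(ρ)`, with `ρ` of
order 3, the same orbits as `R(ρ)`, so on each orbit it is `R(ρ)` or its inverse: a sign. Orbits of
different signs are joined completely or not at all, so automorphisms can be applied to one sign
class alone. If the signs are constant on copies and `m ≤ 5`, one class has at most two copies,
where the sign can be flipped (`HasFlips`, `exists_sign_eq`). For `D₆` the signs are first made
constant on copies (`exists_sign_const`), and at the end the conjugate of the involution is moved to
`R(τ)`. -/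

@[simp]
theorem rightMul_apply (g : G) (v : Fin m × G) : rightMul m g v = (v.1, v.2 * g) := rfl

theorem cay_adj_iff (S : Fin m → Fin m → Set G) (u v : Fin m × G) :
    (cay S).Adj u v ↔ v.2 * u.2⁻¹ ∈ S u.1 v.1 := by
  constructor
  · rintro ⟨s, hs, h⟩
    simpa [h] using hs
  · intro h
    exact ⟨_, h, by simp⟩

theorem cay_adj_rightMul (S : Fin m → Fin m → Set G) (g : G) (u v : Fin m × G) :
    (cay S).Adj (rightMul m g u) (rightMul m g v) ↔ (cay S).Adj u v := by
  simp [cay_adj_iff, mul_assoc]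

theorem image_adj_apply {V : Type*} (Γ : Digraph V) (σ : Equiv.Perm V) (u v : V) :
    (image Γ σ).Adj (σ u) (σ v) ↔ Γ.Adj u v := by
  constructor
  · rintro ⟨a, b, h, ha, hb⟩
    rwa [← σ.injective ha, ← σ.injective hb]
  · intro h
    exact ⟨u, v, h, rfl, rfl⟩

theorem image_eq_of_adj_iff {V : Type*} {Γ Δ : Digraph V} {σ : Equiv.Perm V}
    (h : ∀ u v, Γ.Adj u v ↔ Δ.Adj (σ u) (σ v)) : image Γ σ = Δ := by
  ext a b
  obtain ⟨u, rfl⟩ := σ.surjective a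
  obtain ⟨v, rfl⟩ := σ.surjective b
  rw [image_adj_apply, h]

/-- The elements of the normalizer of the right multiplications are the maps
`(i, x) ↦ (π i, g i * α x)`. -/
theorem exists_eq_of_mem_normalizer (hm : 0 < m) [Finite G] {n : Equiv.Perm (Fin m × G)}
    (hn : n ∈ Subgroup.normalizer (rightMulGroup m G : Set (Equiv.Perm (Fin m × G)))) :
    ∃ (π : Equiv.Perm (Fin m)) (α : G →* G) (g : Fin m → G), Function.Injective α ∧
      ∀ i x, n (i, x) = (π i, g i * α x) := by
  have key : ∀ x : G, ∃ y : G, ∀ v, n (rightMul m x v) = rightMul m y (n v) := by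
    intro x
    obtain ⟨y, hy⟩ := (Subgroup.mem_normalizer_iff.1 hn (rightMul m x)).1 ⟨x, rfl⟩
    refine ⟨y, fun v => ?_⟩
    rw [hy]
    simp
  choose a ha using key
  -- `R(G)` acts semiregularly, so its elements can be compared at a single vertex; `0 < m` provides
  -- one.
  have h0 : ∀ x y : G, rightMul m x (n (⟨0, hm⟩, 1)) = rightMul m y (n (⟨0, hm⟩, 1)) → x = y := by
    intro x y h
    simpa using h
  have hn1 : ∀ i x, n (i, x) = rightMul m (a x) (n (i, 1)) := by
    intro i x
    rw [← ha]
    simp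
  let α : G →* G :=
    { toFun := a
      map_one' := h0 _ _ (by rw [← ha]; simp)
      map_mul' := fun x y => h0 _ _ (by
        have h1 : rightMul m (a x * a y) (n (⟨0, hm⟩, 1)) =
            rightMul m (a y) (rightMul m (a x) (n (⟨0, hm⟩, 1))) := by simp [mul_assoc]
        rw [h1, ← ha, ← ha, ← ha]
        simp) }
  have hα : ∀ i x, n (i, x) = ((n (i, 1)).1, (n (i, 1)).2 * α x) := fun i x => hn1 i x
  have hsurj : Function.Surjective fun i => (n (i, 1)).1 := by
    intro j
    obtain ⟨⟨i, x⟩, hv⟩ := n.surjective (j, 1)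
    refine ⟨i, ?_⟩
    rw [hα] at hv
    exact congrArg Prod.fst hv
  refine ⟨Equiv.ofBijective _ (Finite.injective_iff_bijective.1
    (Finite.injective_iff_surjective.2 hsurj)), α, fun i => (n (i, 1)).2, ?_, fun i x => hα i x⟩
  intro x y hxy
  have : n (⟨0, hm⟩, x) = n (⟨0, hm⟩, y) := by
    rw [hα _ x, hα _ y, hxy]
  simpa using n.injective this

/-- A permutation that conjugates every right multiplication to a right multiplication lies in
the normalizer. -/
theorem mem_normalizer_of_forall [Finite G] {n : Equiv.Perm (Fin m × G)}
    (hn : ∀ x : G, ∃ y : G, n * rightMul m x * n⁻¹ = rightMul m y) :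
    n ∈ Subgroup.normalizer (rightMulGroup m G : Set (Equiv.Perm (Fin m × G))) := by
  rw [Subgroup.mem_normalizer_iff_conj_image_eq]
  refine Set.eq_of_subset_of_ncard_le ?_ ?_ (Set.toFinite _)
  · rintro _ ⟨_, ⟨x, rfl⟩, rfl⟩
    obtain ⟨y, hy⟩ := hn x
    exact ⟨y, hy.symm⟩
  · rw [Set.ncard_image_of_injective _ (MulEquiv.injective _)]

/-! ### Passing to a subgroup -/

/-- Sets on `k` copies of `H`, transported along `ι : H →* G` and padded with empty sets to
`m` copies of `G`. -/
def padded {k : ℕ} {H : Type*} [Group H] (m : ℕ) (ι : H →* G) (S : Fin k → Fin k → Set H) :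
    Fin m → Fin m → Set G :=
  fun i j => {x | ∃ (hi : i.1 < k) (hj : j.1 < k), x ∈ ι '' S ⟨i, hi⟩ ⟨j, hj⟩}

section padded

variable {k : ℕ} {H : Type*} [Group H] (ι : H →* G) {S T : Fin k → Fin k → Set H}

theorem padded_castLE (hkm : k ≤ m) (i j : Fin k) :
    padded m ι S (Fin.castLE hkm i) (Fin.castLE hkm j) = ι '' S i j := by
  ext x
  simp [padded]

theorem padded_self (hS : ∀ i, S i i = ∅) (i : Fin m) : padded m ι S i i = ∅ := by
  ext x
  simp [padded, hS]

theorem isPCayleyDigraph_padded (hS : ∀ i, S i i = ∅) :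
    IsPCayleyDigraph (cay (padded m ι S)) :=
  ⟨_, padded_self ι hS, rfl⟩

theorem isGraph_cay {S : Fin m → Fin m → Set G} (hS : ∀ i j s, s ∈ S i j → s⁻¹ ∈ S j i) :
    IsGraph (cay S) := by
  intro u v h
  rw [cay_adj_iff] at h ⊢
  simpa using hS _ _ _ h

theorem isGraph_padded (hS : ∀ i j s, s ∈ S i j → s⁻¹ ∈ S j i) :
    IsGraph (cay (padded m ι S)) := by
  refine isGraph_cay ?_
  rintro i j _ ⟨hi, hj, s, hs, rfl⟩
  exact ⟨hj, hi, s⁻¹, hS _ _ _ hs, map_inv _ _⟩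

/-- Coordinates of `G` along the right cosets of the image of `H`. -/
theorem exists_coset_coordinates {ι : H →* G} (hι : Function.Injective ι) :
    ∃ (h : G → H) (q : G → G), (∀ x, x = ι (h x) * q x) ∧
      (∀ (y : H) x, h (ι y * q x) = y ∧ q (ι y * q x) = q x) := by
  obtain ⟨T, hT, -⟩ := ι.range.exists_isComplement_right 1
  let e := MonoidHom.ofInjective hι
  refine ⟨fun x => e.symm (hT.equiv x).1, fun x => (hT.equiv x).2, fun x => ?_, fun y x => ?_⟩
  · have h1 : ∀ z : ι.range, ι (e.symm z) = z := fun z =>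
      congrArg Subtype.val (e.apply_symm_apply z)
    change x = ι (e.symm (hT.equiv x).1) * _
    rw [h1]
    exact (hT.equiv_fst_mul_equiv_snd x).symm
  · have h2 : hT.equiv (ι y * (hT.equiv x).2) = (e y, (hT.equiv x).2) := by
      rw [← Equiv.eq_symm_apply]
      rfl
    constructor
    · change e.symm (hT.equiv _).1 = y
      rw [h2]
      simp
    · change ((hT.equiv _).2 : G) = _
      rw [h2]

/-- Arcs of a padded digraph join only vertices whose group elements lie in the same right coset of
the image of `H`. Hence `φ` can be applied in all cosets at once, and copies beyond the first `k`
stay fixed. -/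
theorem pIsomorphic_padded {ι : H →* G} (hι : Function.Injective ι) (φ : Fin k → Equiv.Perm H)
    (hφ : ∀ i j x y, y * x⁻¹ ∈ S i j ↔ φ j y * (φ i x)⁻¹ ∈ T i j) :
    PIsomorphic (cay (padded m ι S)) (cay (padded m ι T)) := by
  obtain ⟨h, q, hq, hhq⟩ := exists_coset_coordinates hι
  let f : Equiv.Perm H → Equiv.Perm G := fun θ =>
    { toFun := fun x => ι (θ (h x)) * q x
      invFun := fun x => ι (θ.symm (h x)) * q x
      left_inv := fun x => by simp only [hhq]; simp [← hq x]
      right_inv := fun x => by simp only [hhq]; simp [← hq x] }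
  have hf : ∀ θ x, f θ x = ι (θ (h x)) * q x := fun _ _ => rfl
  let ψ : Fin m → Equiv.Perm G := fun i => if hi : i.1 < k then f (φ ⟨i, hi⟩) else 1
  refine ⟨⟨fun v => (v.1, ψ v.1 v.2), fun v => (v.1, (ψ v.1).symm v.2),
    fun v => by simp, fun v => by simp⟩, ?_, fun i => ⟨i, ?_⟩⟩
  · have hqq : ∀ x y : G, y * x⁻¹ ∈ ι.range → q y = q x := by
      rintro x y ⟨z, hz⟩
      have : y = ι (z * h x) * q x := by
        rw [map_mul, mul_assoc, ← hq, hz]; simp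
      rw [this]
      exact (hhq _ _).2
    rintro ⟨i, x⟩ ⟨j, y⟩
    simp only [cay_adj_iff, Equiv.coe_fn_mk, padded, Set.mem_ofPred_eq]
    refine exists_congr fun hi => exists_congr fun hj => ?_
    simp only [ψ, hi, hj, dite_true, hf]
    have haux : ∀ (a b : H) (x y : G), q y = q x →
        (ι b * q y) * (ι a * q x)⁻¹ = ι (b * a⁻¹) := by
      intro a b x y hxy
      simp [hxy, mul_assoc]
    have haux' : ∀ (A : Set H) (z : H), ι z ∈ ι '' A ↔ z ∈ A := fun A z => hι.mem_set_image
    constructor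
    · intro hs
      have hxy : q y = q x := hqq x y (Set.image_subset_range _ _ hs)
      rw [hq y, hq x, haux _ _ _ _ hxy, haux'] at hs
      rw [haux _ _ _ _ hxy, haux', ← hφ]
      exact hs
    · intro hs
      have hxy : q y = q x := by
        have := hqq _ _ (Set.image_subset_range _ _ hs)
        rwa [(hhq _ _).2, (hhq _ _).2] at this
      rw [haux _ _ _ _ hxy, haux', ← hφ] at hs
      rw [hq y, hq x, haux _ _ _ _ hxy, haux']
      exact hs
  · ext ⟨j, x⟩
    simp only [block, Set.mem_image, Set.mem_ofPred_eq, Equiv.coe_fn_mk, Prod.exists]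
    constructor
    · rintro ⟨j, x, rfl, h⟩
      exact (congrArg Prod.fst h).symm
    · rintro rfl
      exact ⟨j, (ψ j).symm x, rfl, by simp⟩

/-- If two padded digraphs on copies of `G` are related by the normalizer, then the given
digraphs on copies of `H` are related by the normalizer, provided that they are connected. -/
theorem exists_of_isPCI_padded [Finite G] {k : ℕ} {S T : Fin (k + 2) → Fin (k + 2) → Set H}
    {ι : H →* G} (hι : Function.Injective ι) (hkm : k + 2 ≤ m)
    (hT : ∀ i, T i i = ∅) (φ : Fin (k + 2) → Equiv.Perm H)
    (hφ : ∀ i j x y, y * x⁻¹ ∈ S i j ↔ φ j y * (φ i x)⁻¹ ∈ T i j)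
    (hconn : ∀ i : Fin (k + 2), i ≠ 0 → ∃ j < i, 1 ∈ S j i)
    (hgen : Subgroup.closure (⋃ i, ⋃ j, S i j) = ⊤)
    (h : IsPCI (cay (padded m ι S))) :
    ∃ (π : Equiv.Perm (Fin (k + 2))) (α : H →* H) (g : Fin (k + 2) → H), Function.Injective α ∧
      ∀ i j s, s ∈ S i j ↔ g j * α s * (g i)⁻¹ ∈ T (π i) (π j) := by
  obtain ⟨n, hn, hST⟩ := h _ (isPCayleyDigraph_padded ι hT) (pIsomorphic_padded hι φ hφ)
  obtain ⟨π, α, g, hα, hnf⟩ := exists_eq_of_mem_normalizer (by omega) hn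
  have hmem : ∀ i j s, s ∈ padded m ι S i j ↔
      g j * α s * (g i)⁻¹ ∈ padded m ι T (π i) (π j) := by
    intro i j s
    have := image_adj_apply (cay (padded m ι S)) n (i, 1) (j, s)
    rw [hST, cay_adj_iff, cay_adj_iff, hnf, hnf] at this
    simpa using this.symm
  have hmem' : ∀ i j s, s ∈ S i j → ∃ hi hj, g (Fin.castLE hkm j) * α (ι s) *
      (g (Fin.castLE hkm i))⁻¹ ∈ ι '' T ⟨π (Fin.castLE hkm i), hi⟩ ⟨π (Fin.castLE hkm j), hj⟩ := by
    intro i j s hs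
    refine (hmem _ _ _).1 ?_
    rw [padded_castLE]
    exact ⟨s, hs, rfl⟩
  -- Copies beyond the first `k + 2` carry no arcs, whereas each of these does: copy `i ≠ 0` by
  -- `hconn`, and copy 0 through its arcs to copy 1, which exists because there are at least two
  -- copies.
  have hπ : ∀ i : Fin (k + 2), (π (Fin.castLE hkm i)).1 < k + 2 := by
    intro i
    by_cases hi : i = 0
    · subst hi
      obtain ⟨j, hj, hs⟩ := hconn 1 (by simp)
      obtain rfl : j = 0 := by
        rw [Fin.lt_def, Fin.val_one] at hj
        exact Fin.ext (by rw [Fin.val_zero]; omega)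
      exact (hmem' _ _ _ hs).1
    · obtain ⟨j, hj, hs⟩ := hconn i hi
      exact (hmem' _ _ _ hs).2.1
  let π' : Equiv.Perm (Fin (k + 2)) := Equiv.ofBijective
    (fun i => ⟨π (Fin.castLE hkm i), hπ i⟩) (Finite.injective_iff_bijective.1 (by
      intro i j hij
      have := π.injective (Fin.ext (Fin.mk.inj_iff.1 hij))
      simpa using this))
  have hπ' : ∀ i, π (Fin.castLE hkm i) = Fin.castLE hkm (π' i) := fun i => rfl
  set g' : Fin (k + 2) → G := fun i => g (Fin.castLE hkm i) with hg'
  have hmem2 : ∀ i j (s : H), s ∈ S i j ↔ g' j * α (ι s) * (g' i)⁻¹ ∈ ι '' T (π' i) (π' j) := by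
    intro i j s
    rw [← padded_castLE (m := m) ι hkm, ← hπ', ← hπ', hg', ← hmem, padded_castLE,
      hι.mem_set_image]
  -- conjugate so that the first translation becomes trivial
  let β : G →* G := (MulAut.conj (g' 0)).toMonoidHom.comp α
  have hβ : ∀ x, β x = g' 0 * α x * (g' 0)⁻¹ := fun x => rfl
  -- Induction along the arcs labelled `1`, which contain a spanning tree rooted at copy 0.
  have hg0 : ∀ i, g' i * (g' 0)⁻¹ ∈ ι.range := by
    intro i
    induction i using WellFoundedLT.induction with
    | _ i ih =>
      by_cases hi : i = 0
      · simp [hi]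
      · obtain ⟨j, hj, hs⟩ := hconn i hi
        have h1 := Set.image_subset_range _ _ ((hmem2 j i 1).1 hs)
        have h2 : g' i * (g' 0)⁻¹ = (g' i * α (ι 1) * (g' j)⁻¹) * (g' j * (g' 0)⁻¹) := by
          simp
        rw [h2]
        exact mul_mem h1 (ih j hj)
  have hβS : ∀ i j, ∀ s ∈ S i j, β (ι s) ∈ ι.range := by
    intro i j s hs
    have h1 := Set.image_subset_range _ _ ((hmem2 i j s).1 hs)
    have h2 : β (ι s) = (g' j * (g' 0)⁻¹)⁻¹ * (g' j * α (ι s) * (g' i)⁻¹) *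
        (g' i * (g' 0)⁻¹) := by rw [hβ]; group
    rw [h2]
    exact mul_mem (mul_mem (inv_mem (hg0 j)) h1) (hg0 i)
  have hβH : ∀ s : H, β (ι s) ∈ ι.range := by
    have : (⊤ : Subgroup H) ≤ ι.range.comap (β.comp ι) := by
      rw [← hgen, Subgroup.closure_le]
      intro s hs
      obtain ⟨i, hs⟩ := Set.mem_iUnion.1 hs
      obtain ⟨j, hs⟩ := Set.mem_iUnion.1 hs
      exact hβS i j s hs
    exact fun s => this (Subgroup.mem_top s)
  let e := MonoidHom.ofInjective hι
  have he : ∀ z : ι.range, ι (e.symm z) = z := fun z =>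
    congrArg Subtype.val (e.apply_symm_apply z)
  let γ : H →* H := e.symm.toMonoidHom.comp ((β.comp ι).codRestrict ι.range hβH)
  have hγ : ∀ s, ι (γ s) = β (ι s) := fun s => he _
  refine ⟨π', γ, fun i => e.symm ⟨_, hg0 i⟩, ?_, fun i j s => ?_⟩
  · intro s t hst
    have := congrArg ι hst
    rw [hγ, hγ, hβ, hβ] at this
    exact hι (hα (by simpa using this))
  · rw [hmem2, ← hι.mem_set_image (s := T _ _), map_mul, map_mul, map_inv, he, he, hγ, hβ]
    refine iff_of_eq (congrArg (· ∈ _) ?_)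
    group

end padded

open scoped Pointwise

/-! ### Groups that are not `m`PCI -/

/-! ### The square construction -/

section square

variable {H : Type*} [CommGroup H]

/-- Sets on four copies of `H`, arranged in a square with opposite sides `A`, `X` and `C`, `C`. -/
def squareSets (C : Subgroup H) (A X : Set H) : Fin 4 → Fin 4 → Set H
  | 0, 1 => A
  | 1, 0 => A⁻¹
  | 2, 3 => X
  | 3, 2 => X⁻¹
  | 0, 2 => C
  | 2, 0 => C
  | 1, 3 => C
  | 3, 1 => C
  | _, _ => ∅

/-- The pairs of opposite sides of the square with the labels `A` and `X`. -/
def squareA : Finset (Fin 4 × Fin 4) := {(0, 1), (1, 0), (2, 3), (3, 2)}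

/-- The pairs of opposite sides of the square with the label `C`. -/
def squareC : Finset (Fin 4 × Fin 4) := {(0, 2), (2, 0), (1, 3), (3, 1)}

variable {C : Subgroup H} {A B X : Set H}

theorem squareSets_self (i : Fin 4) : squareSets C A X i i = ∅ := by
  fin_cases i <;> rfl

theorem squareSets_symm (i j : Fin 4) (s : H) (hs : s ∈ squareSets C A X i j) :
    s⁻¹ ∈ squareSets C A X j i := by
  fin_cases i <;> fin_cases j <;> simp_all [squareSets]

theorem squareSets_cases (i j : Fin 4) (h : (squareSets C A X i j).Nonempty) :
    (i, j) ∈ squareA ∨ (squareSets C A X i j = C ∧ (i, j) ∈ squareC) := by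
  fin_cases i <;> fin_cases j <;> simp_all [squareSets, squareA, squareC]

-- If both `A`-sides go to `A`-sides and a `C`-side goes to some side, only the four symmetries of a
-- rectangle remain.
set_option synthInstance.maxHeartbeats 200000 in
set_option synthInstance.maxSize 1000 in
theorem perm_square_cases : ∀ p q r s : Fin 4, p ≠ r → p ≠ s → q ≠ r → q ≠ s →
    (p, q) ∈ squareA → (r, s) ∈ squareA → (p, r) ∈ squareA ∨ (p, r) ∈ squareC →
    (p = 0 ∧ q = 1 ∧ r = 2 ∧ s = 3) ∨ (p = 1 ∧ q = 0 ∧ r = 3 ∧ s = 2) ∨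
    (p = 2 ∧ q = 3 ∧ r = 0 ∧ s = 1) ∨ (p = 3 ∧ q = 2 ∧ r = 1 ∧ s = 0) := by
  decide

/-- Applying `φ` and `ψ` to copies 2 and 3 turns the side `A` into `B` and keeps the `C`-sides,
since both move points within cosets of `C`. For a normalizer relation, `hAC` forces `A`-sides onto
`A`-sides. The same `α` acts on both, so `A` and `B` differ by a translation, which the `C`-sides
force into `C`; `hne` forbids this. -/
theorem not_isPCIGroup_of_square [Finite G] [Finite H] (hm : 4 ≤ m) {ι : H →* G}
    (hι : Function.Injective ι) (φ ψ : Equiv.Perm H)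
    (hAB : ∀ x y, y * x⁻¹ ∈ A ↔ ψ y * (φ x)⁻¹ ∈ B)
    (hφ : ∀ x, φ x * x⁻¹ ∈ C) (hψ : ∀ x, ψ x * x⁻¹ ∈ C) (hA : 1 ∈ A)
    (hgen : Subgroup.closure (A ∪ C) = ⊤)
    (hAC : ∀ (α : H →* H) (g : H), Function.Injective α → ¬ ∀ s, s ∈ A ↔ g * α s ∈ C)
    (hne : ∀ c ∈ C, ¬ ∀ s, s ∈ A ↔ c * s ∈ B) :
    ¬ IsPCIGroup m G := by
  intro h
  have hC : ∀ (θ : Equiv.Perm H), (∀ x, θ x * x⁻¹ ∈ C) →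
      ∀ x y, (y * x⁻¹ ∈ C ↔ θ y * x⁻¹ ∈ C) ∧ (y * x⁻¹ ∈ C ↔ y * (θ x)⁻¹ ∈ C) := by
    intro θ hθ x y
    constructor
    · have : θ y * x⁻¹ = (θ y * y⁻¹) * (y * x⁻¹) := by group
      rw [this, C.mul_mem_cancel_left (hθ y)]
    · have : y * (θ x)⁻¹ = (y * x⁻¹) * (θ x * x⁻¹)⁻¹ := by group
      rw [this, C.mul_mem_cancel_right (inv_mem (hθ x))]
  obtain ⟨π, α, g, hα, hST⟩ := exists_of_isPCI_padded (S := squareSets C A A)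
    (T := squareSets C A B) hι hm squareSets_self ![1, 1, φ, ψ] (by
      intro i j x y
      fin_cases i <;> fin_cases j <;> simp [squareSets] <;> first
        | exact (hC _ hφ _ _).1
        | exact (hC _ hφ _ _).2
        | exact (hC _ hψ _ _).1
        | exact (hC _ hψ _ _).2
        | simpa using hAB x y
        | simpa using hAB y x)
    (by
      intro i hi
      fin_cases i
      · exact absurd rfl hi
      · exact ⟨0, by decide, hA⟩
      · exact ⟨0, by decide, C.one_mem⟩
      · exact ⟨1, by decide, C.one_mem⟩)
    (by
      rw [eq_top_iff, ← hgen]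
      apply Subgroup.closure_mono
      rintro s (hs | hs)
      · exact Set.mem_iUnion.2 ⟨0, Set.mem_iUnion.2 ⟨1, hs⟩⟩
      · exact Set.mem_iUnion.2 ⟨0, Set.mem_iUnion.2 ⟨2, hs⟩⟩)
    (h _ ⟨isPCayleyDigraph_padded ι squareSets_self, isGraph_padded ι squareSets_symm⟩)
  have hA01 := hST 0 1
  have hA23 := hST 2 3
  have hC02 := (hST 0 2 1).1 C.one_mem
  have hC13 := (hST 1 3 1).1 C.one_mem
  have hsurj : Function.Surjective α := Finite.injective_iff_surjective.1 hα
  have hnC : ∀ i j, (∀ s, s ∈ A ↔ g j * α s * (g i)⁻¹ ∈ squareSets C A B (π i) (π j)) →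
      (π i, π j) ∈ squareA := by
    intro i j hij
    rcases squareSets_cases _ _ ⟨_, (hij 1).1 hA⟩ with h | ⟨h, -⟩
    · exact h
    · refine absurd ?_ (hAC α (g j * (g i)⁻¹) hα)
      intro s
      rw [hij, h, mul_right_comm]
      rfl
  have hπ : ∀ i j : Fin 4, i ≠ j → π i ≠ π j := fun i j hij => π.injective.ne hij
  -- `P` and `Q` are translates of the same set `α '' A`, hence of each other.
  have key : ∀ P Q : Set H, ∀ a b : H, (∀ s, s ∈ A ↔ a * α s ∈ P) → (∀ s, s ∈ A ↔ b * α s ∈ Q) →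
      ∀ t, t ∈ P ↔ a⁻¹ * b * t ∈ Q := by
    intro P Q a b hP hQ t
    obtain ⟨s, hs⟩ := hsurj (a⁻¹ * t)
    have h1 := hP s
    have h2 := hQ s
    rw [hs] at h1 h2
    rw [mul_inv_cancel_left] at h1
    rw [← h1, h2, mul_left_comm, mul_assoc]
  simp only [mul_right_comm _ (α _)] at hA01 hA23
  rw [map_one α, mul_one] at hC02 hC13
  rcases perm_square_cases _ _ _ _ (hπ 0 2 (by decide)) (hπ 0 3 (by decide)) (hπ 1 2 (by decide))
    (hπ 1 3 (by decide)) (hnC 0 1 (hST 0 1)) (hnC 2 3 (hST 2 3))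
    ((squareSets_cases _ _ ⟨_, hC02⟩).imp_right And.right) with
    ⟨h0, h1, h2, h3⟩ | ⟨h0, h1, h2, h3⟩ | ⟨h0, h1, h2, h3⟩ | ⟨h0, h1, h2, h3⟩ <;>
    rw [h0, h2] at hC02 <;> rw [h1, h3] at hC13 <;> rw [h0, h1] at hA01 <;>
    rw [h2, h3] at hA23 <;> change _ ∈ C at hC02 <;> change _ ∈ C at hC13 <;>
    -- In a commutative group the quotient of the two `A`-side translations equals that of the two
    -- `C`-side translations.
    have hc : (g 1 * (g 0)⁻¹)⁻¹ * (g 3 * (g 2)⁻¹) ∈ C := by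
      have h4 : (g 1 * (g 0)⁻¹)⁻¹ * (g 3 * (g 2)⁻¹) = (g 2 * (g 0)⁻¹)⁻¹ * (g 3 * (g 1)⁻¹) := by
        simp only [mul_inv, inv_inv]
        ac_rfl
      rw [h4]
      exact mul_mem (inv_mem hC02) hC13
  -- In the second and fourth symmetries the sides are reversed, so `t` becomes `t⁻¹`; in the third
  -- and fourth, `A` and `B` exchange roles.
  · exact hne _ hc (key A B _ _ hA01 hA23)
  · refine hne _ (inv_mem hc) fun t => ?_
    have := key _ _ _ _ hA01 hA23 t⁻¹
    simpa [squareSets, mul_comm] using this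
  · refine hne _ (inv_mem hc) fun t => ?_
    have := key _ _ _ _ hA23 hA01 t
    simpa [squareSets, mul_comm] using this
  · refine hne _ hc fun t => ?_
    have := key _ _ _ _ hA23 hA01 t⁻¹
    simpa [squareSets, mul_comm, mul_left_comm] using this

end square

theorem not_isPCIGroup_of_pair [Finite G] {H : Type*} [CommGroup H] [Finite H] (hm : 4 ≤ m)
    {ι : H →* G} (hι : Function.Injective ι) {a b : H} (φ : Equiv.Perm H)
    (hφ : ∀ x, φ (a * x) = b * φ x) (ha : a ≠ 1) (hab : b ≠ a) (hab' : b ≠ a⁻¹) :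
    ¬ IsPCIGroup m G := by
  have hb : b ≠ 1 := by
    rintro rfl
    exact ha (by simpa using hφ 1)
  refine not_isPCIGroup_of_square (C := ⊤) (A := {1, a}) (B := {1, b}) hm hι φ φ ?_
    (fun _ => Subgroup.mem_top _) (fun _ => Subgroup.mem_top _) (by simp) ?_ ?_ ?_
  · intro x y
    simp only [Set.mem_insert_iff, Set.mem_singleton_iff, one_mul, mul_inv_eq_iff_eq_mul,
      ← hφ, φ.injective.eq_iff]
  · rw [Subgroup.coe_top, Set.union_univ, Subgroup.closure_univ]
  · intro α g _ h
    have := (h b).2 (Subgroup.mem_top _)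
    simp [hb, hab] at this
  · intro c _ h
    have h1 := (h 1).1 (by simp)
    have h2 := (h a).1 (by simp)
    simp only [mul_one, Set.mem_insert_iff, Set.mem_singleton_iff] at h1 h2
    rcases h1 with rfl | rfl
    · rw [one_mul] at h2
      exact h2.elim ha fun h => hab h.symm
    · rcases h2 with h2 | h2
      · exact hab' (eq_inv_of_mul_eq_one_left h2)
      · exact ha (by simpa using h2)

theorem exists_zmod_hom_injective [Finite G] {n : ℕ} {g : G} (hg : orderOf g = n) :
    ∃ ι : Multiplicative (ZMod n) →* G, Function.Injective ι := by
  subst hg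
  have e := zmodCyclicMulEquiv (inferInstance : IsCyclic (Subgroup.zpowers g))
  rw [Nat.card_zpowers] at e
  exact ⟨(Subgroup.zpowers g).subtype.comp e.toMonoidHom,
    (Subgroup.subtype_injective _).comp e.injective⟩

theorem closure_eq_top_of_ofAdd_one_mem {n : ℕ} [NeZero n] {s : Set (Multiplicative (ZMod n))}
    (h : Multiplicative.ofAdd 1 ∈ s) : Subgroup.closure s = ⊤ := by
  rw [eq_top_iff]
  intro x _
  have : x = Multiplicative.ofAdd (1 : ZMod n) ^ (x.toAdd).val := by
    rw [← ofAdd_nsmul, nsmul_eq_mul, mul_one, ZMod.natCast_rightInverse]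
    rfl
  rw [this]
  exact pow_mem (Subgroup.subset_closure h) _

/-- In odd order, squaring is a permutation and turns multiplication by a generator `a` into
multiplication by `a ^ 2`. Order at least 5 separates `a ^ 2` from `a` and `a⁻¹`. -/
theorem not_isPCIGroup_of_orderOf_odd [Finite G] (hm : 4 ≤ m) {g : G} (h5 : 5 ≤ orderOf g)
    (hodd : Odd (orderOf g)) : ¬ IsPCIGroup m G := by
  obtain ⟨ι, hι⟩ := exists_zmod_hom_injective (rfl : orderOf g = _)
  have : NeZero (orderOf g) := ⟨by omega⟩
  have ho : orderOf (Multiplicative.ofAdd (1 : ZMod (orderOf g))) = orderOf g := by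
    rw [orderOf_ofAdd_eq_addOrderOf, ZMod.addOrderOf_one]
  have hcop : (Nat.card (Multiplicative (ZMod (orderOf g)))).Coprime 2 := by
    rw [Nat.card_eq_fintype_card, Fintype.card_multiplicative, ZMod.card]
    exact hodd.coprime_two_right
  have hne : ∀ k, 0 < k → k < 5 → Multiplicative.ofAdd (1 : ZMod (orderOf g)) ^ k ≠ 1 := by
    intro k hk hk5 h
    have := Nat.le_of_dvd hk (orderOf_dvd_of_pow_eq_one h)
    omega
  refine not_isPCIGroup_of_pair hm hι (a := Multiplicative.ofAdd 1)
    (b := Multiplicative.ofAdd 1 ^ 2) (powCoprime hcop)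
    (fun x => by simp [mul_pow]) ?_ ?_ ?_
  · simpa using hne 1
  · intro h
    refine hne 1 (by norm_num) (by norm_num) ?_
    rw [pow_two] at h
    simpa using h
  · intro h
    refine hne 3 (by norm_num) (by norm_num) ?_
    rw [pow_succ, h, inv_mul_cancel]

/-- Both left multiplications consist of `p`-cycles without fixed points, so they have the same
cycle type and are conjugate. -/
theorem exists_perm_mul_left {H : Type*} [Group H] [Finite H] {p : ℕ} (hp : p.Prime) {a b : H}
    (ha : orderOf a = p) (hb : orderOf b = p) :
    ∃ φ : Equiv.Perm H, ∀ x, φ (a * x) = b * φ x := by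
  classical
  have := Fintype.ofFinite H
  have := Fact.mk hp
  have key : ∀ c : H, orderOf c = p → (Equiv.mulLeft c).cycleType =
      Multiset.replicate (Fintype.card H / p) p := by
    intro c hc
    have h1 : (Equiv.mulLeft c) ^ p = 1 := by
      rw [← hc, Equiv.pow_mulLeft, pow_orderOf_eq_one, Equiv.mulLeft_one]
    have h2 := Equiv.Perm.cycleType_of_pow_prime_eq_one h1
    have h3 : (Equiv.mulLeft c).support = Finset.univ := by
      ext x
      have : c ≠ 1 := by
        rintro rfl
        rw [orderOf_one] at hc
        exact hp.one_lt.ne hc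
      simpa using this
    have h4 := (Equiv.mulLeft c).sum_cycleType
    rw [h2, h3, Multiset.sum_replicate, Finset.card_univ, smul_eq_mul] at h4
    rw [← h4, Nat.mul_div_cancel _ hp.pos, ← h2]
  obtain ⟨φ, hφ⟩ := isConj_iff.1
    (Equiv.Perm.isConj_iff_cycleType_eq.2 ((key a ha).trans (key b hb).symm))
  refine ⟨φ, fun x => ?_⟩
  have := congrArg (fun f : Equiv.Perm H => f (φ x)) hφ
  simpa using this

theorem not_isPCIGroup_of_not_isCyclic [Finite G] (hm : 4 ≤ m) {p : ℕ} (hp : p.Prime)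
    (K : Subgroup G) (hK : Nat.card K = p ^ 2) (hcyc : ¬ IsCyclic K) : ¬ IsPCIGroup m G := by
  have := Fact.mk hp
  let inst : CommGroup K := IsPGroup.commGroupOfCardEqPrimeSq hK
  have hord : ∀ x : K, x ≠ 1 → orderOf x = p := by
    intro x hx
    obtain ⟨k, hk, hxk⟩ := (Nat.dvd_prime_pow hp).1 (hK ▸ orderOf_dvd_natCard x)
    interval_cases k
    · exact absurd (orderOf_eq_one_iff.1 (by simpa using hxk)) hx
    · simpa using hxk
    · exact absurd (isCyclic_of_orderOf_eq_card x (hxk.trans hK.symm)) hcyc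
  have hcard : 1 < Nat.card K := by
    rw [hK]
    exact Nat.one_lt_pow (by norm_num) hp.one_lt
  have := (Finite.one_lt_card_iff_nontrivial).1 hcard
  obtain ⟨a, ha⟩ := exists_ne (1 : K)
  obtain ⟨b, hb⟩ : ∃ b : K, b ∉ Subgroup.zpowers a := by
    by_contra! h
    exact hcyc ⟨a, h⟩
  have hb1 : b ≠ 1 := by
    rintro rfl
    exact hb (one_mem _)
  obtain ⟨φ, hφ⟩ := exists_perm_mul_left hp (hord a ha) (hord b hb1)
  refine not_isPCIGroup_of_pair hm (ι := K.subtype) K.subtype_injective φ hφ ha ?_ ?_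
  · rintro rfl
    exact hb (Subgroup.mem_zpowers _)
  · rintro rfl
    exact hb (inv_mem (Subgroup.mem_zpowers _))

/-- Here `B` is a translate of `A`, but only by an element of order 4, so `C` has to be proper.
Inversion moves `x` by `x⁻²`, which lies in the subgroup `C` of elements with square 1. -/
theorem not_isPCIGroup_of_orderOf_eq_four [Finite G] (hm : 4 ≤ m) {g : G} (hg : orderOf g = 4) :
    ¬ IsPCIGroup m G := by
  obtain ⟨ι, hι⟩ := exists_zmod_hom_injective hg
  have hmem : ∀ x : Multiplicative (ZMod 4), x ∈ (powMonoidHom 2).ker ↔ x ^ 2 = 1 :=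
    fun x => Iff.rfl
  refine not_isPCIGroup_of_square (C := (powMonoidHom 2).ker) (A := {1, Multiplicative.ofAdd 1})
    (B := {1, Multiplicative.ofAdd 3}) hm hι (Equiv.inv _) (Equiv.inv _) ?_ ?_ ?_ (by simp)
    (closure_eq_top_of_ofAdd_one_mem (by simp)) ?_ ?_
  · simp only [Equiv.inv_apply, Set.mem_insert_iff, Set.mem_singleton_iff]
    decide
  · simp only [hmem, Equiv.inv_apply]
    decide
  · simp only [hmem, Equiv.inv_apply]
    decide
  · intro α g hα h
    have h1 := (h 1).1 (by simp)
    have h2 := (h (Multiplicative.ofAdd 1)).1 (by simp)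
    rw [map_one, mul_one] at h1
    have h3 := (Subgroup.mul_mem_cancel_left _ h1).1 h2
    rw [hmem, ← map_pow, map_eq_one_iff α hα] at h3
    revert h3
    decide
  · simp only [hmem, Set.mem_insert_iff, Set.mem_singleton_iff]
    decide

/-- Inversion takes `{0, 1, 3}` to `{0, 5, 3}`, which is not a translate: the cyclic gaps 1, 2, 3
occur in the opposite order. -/
theorem not_isPCIGroup_of_orderOf_eq_six [Finite G] (hm : 4 ≤ m) {g : G} (hg : orderOf g = 6) :
    ¬ IsPCIGroup m G := by
  obtain ⟨ι, hι⟩ := exists_zmod_hom_injective hg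
  refine not_isPCIGroup_of_square (C := ⊤)
    (A := {1, Multiplicative.ofAdd 1, Multiplicative.ofAdd 3})
    (B := {1, Multiplicative.ofAdd 5, Multiplicative.ofAdd 3}) hm hι (Equiv.inv _) (Equiv.inv _)
    ?_ (fun _ => Subgroup.mem_top _) (fun _ => Subgroup.mem_top _) (by simp)
    (closure_eq_top_of_ofAdd_one_mem (by simp)) ?_ ?_
  · simp only [Equiv.inv_apply, Set.mem_insert_iff, Set.mem_singleton_iff]
    decide
  · intro α g _ h
    have := (h (Multiplicative.ofAdd 2)).2 (Subgroup.mem_top _)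
    revert this
    simp only [Set.mem_insert_iff, Set.mem_singleton_iff]
    decide
  · simp only [Subgroup.mem_top, forall_const, Set.mem_insert_iff, Set.mem_singleton_iff]
    decide

/-! ### Groups of order divisible by three -/

/-- Sets on six copies of the cyclic group of order three: two triangles, with the voltages
`ofAdd 1` and `x`, and with a pattern of complete connections between them. -/
def triangleSets (x : Multiplicative (ZMod 3)) : Fin 6 → Fin 6 → Finset (Multiplicative (ZMod 3))
  | 0, 1 => {1}
  | 1, 0 => {1}
  | 1, 2 => {1}
  | 2, 1 => {1}
  | 0, 2 => {Multiplicative.ofAdd 1}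
  | 2, 0 => {Multiplicative.ofAdd 2}
  | 3, 5 => {1}
  | 5, 3 => {1}
  | 4, 5 => {1}ᶜ
  | 5, 4 => {1}ᶜ
  | 3, 4 => {x}ᶜ
  | 4, 3 => {x⁻¹}ᶜ
  | 0, 3 => Finset.univ
  | 3, 0 => Finset.univ
  | 0, 4 => Finset.univ
  | 4, 0 => Finset.univ
  | 1, 3 => Finset.univ
  | 3, 1 => Finset.univ
  | _, _ => ∅

/-- Inverting the last three copies changes the voltage of the second triangle only. A normalizer
relation fixes every copy, so the first triangle makes `α` fix `ofAdd 1` while the second makes `α`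
invert it. -/
theorem not_isPCIGroup_of_orderOf_eq_three [Finite G] (hm : 6 ≤ m) {g : G} (hg : orderOf g = 3) :
    ¬ IsPCIGroup m G := by
  intro h
  obtain ⟨ι, hι⟩ := exists_zmod_hom_injective hg
  have hself : ∀ x i, (triangleSets x i i : Set (Multiplicative (ZMod 3))) = ∅ := by
    simp only [Finset.coe_eq_empty]
    decide
  obtain ⟨π, α, g, hα, hST⟩ := exists_of_isPCI_padded
    (S := fun i j => triangleSets (Multiplicative.ofAdd 1) i j)
    (T := fun i j => triangleSets (Multiplicative.ofAdd 2) i j) hι hm (hself _)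
    ![1, 1, 1, Equiv.inv _, Equiv.inv _, Equiv.inv _]
    (by
      simp only [Finset.mem_coe]
      decide)
    (by
      simp only [Finset.mem_coe]
      decide)
    (by
      refine closure_eq_top_of_ofAdd_one_mem ?_
      exact Set.mem_iUnion.2 ⟨0, Set.mem_iUnion.2 ⟨2, by simp [triangleSets]⟩⟩)
    (h _ ⟨isPCayleyDigraph_padded ι (hself _), isGraph_padded ι (by
      simp only [Finset.mem_coe]
      decide)⟩)
  simp only [Finset.mem_coe] at hST
  have hcard : ∀ i j, (triangleSets (Multiplicative.ofAdd 1) i j).card =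
      (triangleSets (Multiplicative.ofAdd 1) (π i) (π j)).card := by
    have h1 : ∀ i j, (triangleSets (Multiplicative.ofAdd 1) i j).card =
      (triangleSets (Multiplicative.ofAdd 2) i j).card := by decide
    intro i j
    rw [h1 (π i)]
    refine Finset.card_nbij (fun s => g j * α s * (g i)⁻¹) (fun s hs => (hST i j s).1 hs)
      (fun s _ t _ hst => hα (by simpa using hst)) fun t ht => ?_
    obtain ⟨s, hs⟩ := Finite.injective_iff_surjective.1 hα ((g j)⁻¹ * t * g i)
    have hst : g j * α s * (g i)⁻¹ = t := by
      rw [hs]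
      group
    exact ⟨s, (hST i j s).2 (hst ▸ ht), hst⟩
  -- The valencies of the six copies are 8, 5, 2, 9, 7, 3, all different.
  have hπ : ∀ i, π i = i := by
    have hinj : Function.Injective fun i =>
        ∑ j, (triangleSets (Multiplicative.ofAdd 1) i j).card := by
      decide
    intro i
    refine hinj ?_
    change ∑ j, _ = ∑ j, _
    rw [← Equiv.sum_comp π]
    exact Finset.sum_congr rfl fun j _ => (hcard i j).symm
  simp only [hπ] at hST
  have h01 := (hST 0 1 1).1 (by decide)
  have h12 := (hST 1 2 1).1 (by decide)
  have h02 := (hST 0 2 (Multiplicative.ofAdd 1)).1 (by decide)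
  have h35 := (hST 3 5 1).1 (by decide)
  have h45 := (hST 4 5 1).not.1 (by decide)
  have h34 := (hST 3 4 (Multiplicative.ofAdd 1)).not.1 (by decide)
  simp only [triangleSets, Finset.mem_singleton, Finset.mem_compl, not_not, map_one, mul_one,
    one_mul, mul_inv_eq_iff_eq_mul] at h01 h12 h02 h35 h45 h34
  rw [h12, h01, mul_comm, mul_right_cancel_iff] at h02
  rw [← h45, h35, mul_comm, mul_right_cancel_iff, h02] at h34
  revert h34
  decide

/-- Sets on four copies of the cyclic group of order three: two directed cycles of length six,
with the voltages `ofAdd 1` and `x`, and complete connections from the first to the third copy. -/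
def dicycleSets (x : Multiplicative (ZMod 3)) : Fin 4 → Fin 4 → Finset (Multiplicative (ZMod 3))
  | 0, 1 => {1}
  | 1, 0 => {Multiplicative.ofAdd 1}
  | 2, 3 => {1}
  | 3, 2 => {x}
  | 0, 2 => Finset.univ
  | _, _ => ∅

/-- The only connection without a return is from copy 0 to copy 2. The condition `b ≠ c` excludes
walks such as 0, 1, 0 that turn back along one dicycle. -/
theorem dicycleSets_rigid : ∀ a b c d : Fin 4,
    (dicycleSets (Multiplicative.ofAdd 2) a b).Nonempty ∧
    (dicycleSets (Multiplicative.ofAdd 2) b a).Nonempty ∧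
    (dicycleSets (Multiplicative.ofAdd 2) c d).Nonempty ∧
    (dicycleSets (Multiplicative.ofAdd 2) a c).Nonempty ∧ b ≠ c →
    a = 0 ∧ b = 1 ∧ c = 2 ∧ d = 3 := by
  decide

/-- Direction makes two copies enough to carry a nontrivial voltage. The one-way connection fixes
the copies, and the two dicycles then require `α` both to fix and to invert `ofAdd 1`. -/
theorem not_isPDCIGroup_of_orderOf_eq_three [Finite G] (hm : 4 ≤ m) {g : G}
    (hg : orderOf g = 3) : ¬ IsPDCIGroup m G := by
  intro h
  obtain ⟨ι, hι⟩ := exists_zmod_hom_injective hg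
  have hself : ∀ x i, (dicycleSets x i i : Set (Multiplicative (ZMod 3))) = ∅ := by
    simp only [Finset.coe_eq_empty]
    decide
  obtain ⟨π, α, g, hα, hST⟩ := exists_of_isPCI_padded
    (S := fun i j => dicycleSets (Multiplicative.ofAdd 1) i j)
    (T := fun i j => dicycleSets (Multiplicative.ofAdd 2) i j) hι hm (hself _)
    ![1, 1, Equiv.inv _, Equiv.inv _]
    (by
      simp only [Finset.mem_coe]
      decide)
    (by
      simp only [Finset.mem_coe]
      decide)
    (by
      refine closure_eq_top_of_ofAdd_one_mem ?_
      exact Set.mem_iUnion.2 ⟨0, Set.mem_iUnion.2 ⟨2, by simp [dicycleSets]⟩⟩)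
    (h _ (isPCayleyDigraph_padded ι (hself _)))
  simp only [Finset.mem_coe] at hST
  have h01 := (hST 0 1 1).1 (by decide)
  have h10 := (hST 1 0 (Multiplicative.ofAdd 1)).1 (by decide)
  have h23 := (hST 2 3 1).1 (by decide)
  have h32 := (hST 3 2 (Multiplicative.ofAdd 1)).1 (by decide)
  have h02 := (hST 0 2 1).1 (by decide)
  obtain ⟨e0, e1, e2, e3⟩ := dicycleSets_rigid _ _ _ _
    ⟨⟨_, h01⟩, ⟨_, h10⟩, ⟨_, h23⟩, ⟨_, h02⟩, π.injective.ne (by decide)⟩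
  rw [e0, e1] at h01
  rw [e0, e1] at h10
  rw [e2, e3] at h23
  rw [e2, e3] at h32
  simp only [dicycleSets, Finset.mem_singleton, map_one, mul_one,
    one_mul, mul_inv_eq_iff_eq_mul] at h01 h10 h23 h32
  rw [h01, mul_comm, mul_right_cancel_iff] at h10
  rw [h23, mul_comm, mul_right_cancel_iff, h10] at h32
  revert h32
  decide

/-! ### Groups of order dividing six -/

/-- A group of order six without elements of order six is dihedral. -/
theorem nonempty_mulEquiv_dihedralGroup_three [Finite G] (hG : Nat.card G = 6)
    (h6 : ∀ g : G, orderOf g ≠ 6) : Nonempty (G ≃* DihedralGroup 3) := by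
  obtain ⟨a, ha⟩ := exists_prime_orderOf_dvd_card' (G := G) 3 (by rw [hG]; norm_num)
  obtain ⟨b, hb⟩ := exists_prime_orderOf_dvd_card' (G := G) 2 (by rw [hG]; norm_num)
  have ha3 : a ^ 3 = 1 := ha ▸ pow_orderOf_eq_one a
  have hb2 : b * b = 1 := by
    rw [← pow_two, ← hb, pow_orderOf_eq_one b]
  have hindex : (Subgroup.zpowers a).index = 2 := by
    have := (Subgroup.zpowers a).card_mul_index
    rw [Nat.card_zpowers, ha, hG] at this
    omega
  have hnormal := Subgroup.normal_of_index_eq_two hindex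
  -- The conjugate is `a ^ k` with `k < 3`: `k = 0` makes `a` trivial, and `k = 1` makes `b * a` an
  -- element of order 6.
  have hconj : b * a * b⁻¹ = a⁻¹ := by
    have h1 : b * a * b⁻¹ ∈ Subgroup.zpowers a :=
      hnormal.conj_mem _ (Subgroup.mem_zpowers a) b
    classical
    rw [mem_zpowers_iff_mem_range_orderOf, ha] at h1
    obtain ⟨k, hk, hk'⟩ := Finset.mem_image.1 h1
    rw [Finset.mem_range] at hk
    interval_cases k
    · have h2 : a = 1 := by simpa [eq_comm] using hk'
      rw [h2, orderOf_one] at ha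
      norm_num at ha
    · have h2 : Commute b a := by
        rw [pow_one, eq_mul_inv_iff_mul_eq] at hk'
        exact hk'.symm
      refine absurd ?_ (h6 (b * a))
      rw [h2.orderOf_mul_eq_mul_orderOf_of_coprime (by rw [ha, hb]; norm_num), ha, hb]
    · rw [← hk', eq_inv_iff_mul_eq_one, ← pow_succ, ha3]
  have hadd : ∀ i j : ZMod 3, a ^ (i + j).val = a ^ i.val * a ^ j.val := by
    intro i j
    rw [ZMod.val_add, ← pow_add, pow_eq_pow_mod (i.val + j.val) ha3]
  have hsub : ∀ i j : ZMod 3, a ^ (j - i).val = (a ^ i.val)⁻¹ * a ^ j.val := by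
    intro i j
    rw [eq_inv_mul_iff_mul_eq, ← hadd, add_sub_cancel]
  have hab : ∀ k : ℕ, a ^ k * b = b * (a ^ k)⁻¹ := by
    intro k
    have h1 : a * b = b * a⁻¹ := by
      rw [← hconj, mul_assoc, ← mul_assoc b b, hb2, one_mul, inv_eq_of_mul_eq_one_left hb2]
    induction k with
    | zero => simp
    | succ k ih => rw [pow_succ, mul_assoc, h1, ← mul_assoc, ih, mul_assoc, mul_inv_rev,
        ← mul_inv_rev, ← mul_inv_rev, ← pow_succ, ← pow_succ']
  let f : DihedralGroup 3 →* G := MonoidHom.mk' (fun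
      | .r i => a ^ i.val
      | .sr i => b * a ^ i.val) (by
    rintro (i | i) (j | j)
    · exact hadd i j
    · change b * a ^ (j - i).val = a ^ i.val * (b * a ^ j.val)
      rw [hsub, ← mul_assoc, ← hab, mul_assoc]
    · change b * a ^ (i + j).val = b * a ^ i.val * a ^ j.val
      rw [hadd, mul_assoc]
    · change a ^ (j - i).val = b * a ^ i.val * (b * a ^ j.val)
      rw [hsub, mul_assoc, ← mul_assoc (a ^ i.val), hab, mul_assoc b, ← mul_assoc b, hb2, one_mul])
  have hinj : Function.Injective f := by
    rw [injective_iff_map_eq_one]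
    rintro (i | i) h
    · change a ^ i.val = 1 at h
      have h1 := orderOf_dvd_of_pow_eq_one h
      rw [ha] at h1
      have h2 := Nat.eq_zero_of_dvd_of_lt h1 (ZMod.val_lt i)
      rw [ZMod.val_eq_zero] at h2
      rw [h2]
      rfl
    · change b * a ^ i.val = 1 at h
      have h1 : b ∈ Subgroup.zpowers a := by
        rw [eq_inv_of_mul_eq_one_left h]
        exact inv_mem (pow_mem (Subgroup.mem_zpowers a) _)
      have h2 := Subgroup.orderOf_dvd_natCard _ h1
      rw [Nat.card_zpowers, ha, hb] at h2
      norm_num at h2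
  have hbij : Function.Bijective f :=
    (Nat.bijective_iff_injective_and_card f).2 ⟨hinj, by rw [hG, DihedralGroup.nat_card]⟩
  exact ⟨(MulEquiv.ofBijective f hbij).symm⟩

theorem nonempty_mulEquiv_zmod_of_prime {p : ℕ} [hp : Fact p.Prime] (hG : Nat.card G = p) :
    Nonempty (G ≃* Multiplicative (ZMod p)) :=
  ⟨mulEquivOfPrimeCardEq hG (by simp)⟩

/-- A prime divisor `p ≥ 5` gives an element of order `p` by Cauchy. If `p ^ 2` divides the order, a
subgroup of order `p ^ 2` is noncyclic or contains an element of order 4 or 9. -/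
theorem card_dvd_six_of_isPCIGroup [Finite G] (hm : 4 ≤ m) (h : IsPCIGroup m G) :
    Nat.card G ∣ 6 := by
  rw [Nat.dvd_iff_prime_pow_dvd_dvd]
  intro p k hp hk
  have := Fact.mk hp
  rcases k with - | k
  · simp
  have hp4 : p < 5 := by
    by_contra! hp5
    obtain ⟨g, hg⟩ := exists_prime_orderOf_dvd_card' (G := G) p
      (dvd_trans (dvd_pow_self _ (by omega)) hk)
    exact not_isPCIGroup_of_orderOf_odd hm (hg ▸ hp5) (hg ▸ hp.odd_of_ne_two (by omega)) h
  have hk0 : k = 0 := by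
    by_contra hk0
    obtain ⟨K, hK⟩ := Sylow.exists_subgroup_card_pow_prime p
      (dvd_trans (pow_dvd_pow p (by omega : 2 ≤ k + 1)) hk)
    by_cases hcyc : IsCyclic K
    · obtain ⟨g, hg⟩ := IsCyclic.exists_ofOrder_eq_natCard (α := K)
      rw [hK, ← Subgroup.orderOf_coe] at hg
      interval_cases p
      · exact absurd hp (by norm_num)
      · exact absurd hp (by norm_num)
      · exact not_isPCIGroup_of_orderOf_eq_four hm hg h
      · exact not_isPCIGroup_of_orderOf_odd hm (by rw [hg]; norm_num)
          (by rw [hg]; exact ⟨4, rfl⟩) h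
      · exact absurd hp (by norm_num)
    · exact not_isPCIGroup_of_not_isCyclic hm hp K hK hcyc h
  subst hk0
  interval_cases p
  · exact absurd hp (by norm_num)
  · exact absurd hp (by norm_num)
  · norm_num
  · norm_num
  · exact absurd hp (by norm_num)

theorem mulEquiv_of_isPCIGroup [Finite G] (hm : 4 ≤ m) (h : IsPCIGroup m G) :
    Nonempty (G ≃* Multiplicative (ZMod 1)) ∨ Nonempty (G ≃* Multiplicative (ZMod 2)) ∨
      Nonempty (G ≃* Multiplicative (ZMod 3)) ∨ Nonempty (G ≃* DihedralGroup 3) := by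
  have hdvd := card_dvd_six_of_isPCIGroup hm h
  have hpos : 0 < Nat.card G := Nat.card_pos
  have hle := Nat.le_of_dvd (by norm_num) hdvd
  have hcases : Nat.card G = 1 ∨ Nat.card G = 2 ∨ Nat.card G = 3 ∨ Nat.card G = 6 := by
    interval_cases Nat.card G <;> simp_all
  rcases hcases with h1 | h2 | h3 | h6
  · left
    have := (Nat.card_eq_one_iff_unique.1 h1).1
    have := uniqueOfSubsingleton (1 : G)
    exact ⟨MulEquiv.ofUnique⟩
  · exact Or.inr (Or.inl (nonempty_mulEquiv_zmod_of_prime h2))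
  · exact Or.inr (Or.inr (Or.inl (nonempty_mulEquiv_zmod_of_prime h3)))
  · exact Or.inr (Or.inr (Or.inr (nonempty_mulEquiv_dihedralGroup_three h6
      fun g hg => not_isPCIGroup_of_orderOf_eq_six hm hg h)))

theorem IsPDCIGroup.isPCIGroup (h : IsPDCIGroup m G) : IsPCIGroup m G :=
  fun Γ hΓ => h Γ hΓ.1

theorem exists_orderOf_eq_three (h : Nonempty (G ≃* Multiplicative (ZMod 3)) ∨
    Nonempty (G ≃* DihedralGroup 3)) : ∃ g : G, orderOf g = 3 := by
  rcases h with ⟨⟨e⟩⟩ | ⟨⟨e⟩⟩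
  · refine ⟨e.symm (Multiplicative.ofAdd 1), ?_⟩
    rw [MulEquiv.orderOf_eq, orderOf_ofAdd_eq_addOrderOf, ZMod.addOrderOf_one]
  · exact ⟨e.symm (.r 1), by rw [MulEquiv.orderOf_eq, DihedralGroup.orderOf_r_one]⟩

/-! ### Groups that are `m`PCI -/

/-- The automorphisms of a digraph that fix every copy of `G`. -/
def blockAut (Γ : Digraph (Fin m × G)) : Subgroup (Equiv.Perm (Fin m × G)) where
  carrier := {a | (∀ u v, Γ.Adj (a u) (a v) ↔ Γ.Adj u v) ∧ ∀ v, (a v).1 = v.1}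
  one_mem' := ⟨fun _ _ => Iff.rfl, fun _ => rfl⟩
  mul_mem' := by
    rintro a b ⟨ha, ha'⟩ ⟨hb, hb'⟩
    exact ⟨fun u v => (ha _ _).trans (hb u v), fun v => (ha' _).trans (hb' v)⟩
  inv_mem' := by
    rintro a ⟨ha, ha'⟩
    refine ⟨fun u v => ?_, fun v => ?_⟩
    · rw [← ha]
      simp
    · rw [← ha']
      simp

theorem rightMul_mem_blockAut (S : Fin m → Fin m → Set G) (g : G) :
    rightMul m g ∈ blockAut (cay S) :=
  ⟨cay_adj_rightMul S g, fun _ => rfl⟩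

theorem rightMul_mul (g h : G) (v : Fin m × G) :
    rightMul m g (rightMul m h v) = rightMul m (h * g) v := by
  simp [mul_assoc]

/-- The conjugates of the right multiplications by `σ` are automorphisms of `Γ`. -/
def ConjAut (Γ : Digraph (Fin m × G)) (σ : Equiv.Perm (Fin m × G)) : Prop :=
  ∀ x : G, σ⁻¹ * rightMul m x * σ ∈ blockAut Γ

theorem ConjAut.mul {Γ : Digraph (Fin m × G)} {σ a : Equiv.Perm (Fin m × G)}
    (hσ : ConjAut Γ σ) (ha : a ∈ blockAut Γ) : ConjAut Γ (σ * a) := by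
  intro x
  have : (σ * a)⁻¹ * rightMul m x * (σ * a) = a⁻¹ * (σ⁻¹ * rightMul m x * σ) * a := by group
  rw [this]
  exact mul_mem (mul_mem (inv_mem ha) (hσ x)) ha

theorem fst_eq_iff_of_image_block {X : Type*} {σ : Equiv.Perm (Fin m × X)}
    (hσ : ∀ i, ∃ j, σ '' block X i = block X j) (u v : Fin m × X) :
    (σ u).1 = (σ v).1 ↔ u.1 = v.1 := by
  choose π hπ using hσ
  have h1 : ∀ w, (σ w).1 = π w.1 := fun w => by
    have : σ w ∈ block X (π w.1) := hπ w.1 ▸ ⟨w, rfl, rfl⟩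
    exact this
  constructor
  · intro h
    have h2 : σ v ∈ σ '' block X u.1 := by
      rw [hπ]
      change (σ v).1 = _
      rw [← h, h1]
    obtain ⟨w, hw, hwv⟩ := h2
    rw [← σ.injective hwv]
    exact hw.symm
  · intro h
    rw [h1, h1, h]

/-- To show that `Γ` is `m`PCI, it suffices to move `σ` into the normalizer by automorphisms. -/
theorem isPCI_of_forall_conjAut {Γ : Digraph (Fin m × G)}
    (h : ∀ σ : Equiv.Perm (Fin m × G), (∀ u v, (σ u).1 = (σ v).1 ↔ u.1 = v.1) → ConjAut Γ σ →
      ∃ a ∈ blockAut Γ,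
        σ * a ∈ Subgroup.normalizer (rightMulGroup m G : Set (Equiv.Perm (Fin m × G)))) :
    IsPCI Γ := by
  rintro Δ ⟨T, -, rfl⟩ ⟨σ, hσ, hblock⟩
  have hfst := fst_eq_iff_of_image_block hblock
  have hx : ∀ x v, σ ((σ⁻¹ * rightMul m x * σ) v) = rightMul m x (σ v) := by simp
  obtain ⟨a, ha, hn⟩ := h σ hfst (fun x =>
    ⟨fun u v => by rw [hσ, hσ u v, hx, hx, cay_adj_rightMul],
      fun v => by rw [← hfst, hx, rightMul_apply]⟩)
  refine ⟨σ * a, hn, image_eq_of_adj_iff fun u v => ?_⟩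
  rw [← ha.1, hσ]
  rfl

/-- An automorphism can be restricted to a set of vertices that has only trivial connections with
the other vertices. -/
theorem exists_restrict_mem_blockAut {S : Fin m → Fin m → Set G} (hΓ : IsGraph (cay S)) {ρ : G}
    {s : Set (Fin m × G)} (hs : ∀ v, rightMul m ρ v ∈ s ↔ v ∈ s) {f : Equiv.Perm (Fin m × G)}
    (hf : ∀ v, ∃ k : ℕ, f v = rightMul m (ρ ^ k) v)
    (hadj : ∀ u ∈ s, ∀ v ∈ s, (cay S).Adj (f u) (f v) ↔ (cay S).Adj u v)
    (htriv : ∀ u ∈ s, ∀ v ∉ s, (cay S).Adj u (rightMul m ρ v) ↔ (cay S).Adj u v) :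
    ∃ F ∈ blockAut (cay S), (∀ v ∈ s, F v = f v) ∧ ∀ v ∉ s, F v = v := by
  classical
  have hs' : ∀ (k : ℕ) v, rightMul m (ρ ^ k) v ∈ s ↔ v ∈ s := by
    intro k
    induction k with
    | zero => simp
    | succ k ih =>
      intro v
      rw [pow_succ, ← rightMul_mul, hs, ih]
  have hfs : ∀ v, f v ∈ s ↔ v ∈ s := by
    intro v
    obtain ⟨k, hk⟩ := hf v
    rw [hk, hs']
  have htriv' : ∀ (k : ℕ), ∀ u ∈ s, ∀ v ∉ s,
      (cay S).Adj (rightMul m (ρ ^ k) u) v ↔ (cay S).Adj u v := by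
    intro k
    induction k with
    | zero => simp
    | succ k ih =>
      intro u hu v hv
      rw [pow_succ, ← rightMul_mul, ← htriv _ ((hs _).2 ((hs' k u).2 hu)) v hv, cay_adj_rightMul,
        ih u hu v hv]
  have hsymm : ∀ u v, (cay S).Adj u v ↔ (cay S).Adj v u := fun u v => ⟨hΓ u v, hΓ v u⟩
  let F : Equiv.Perm (Fin m × G) := Equiv.Perm.ofSubtype (f.subtypePerm hfs)
  have hF1 : ∀ v ∈ s, F v = f v := fun v hv => by
    rw [Equiv.Perm.ofSubtype_apply_of_mem _ hv]
    rfl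
  have hF2 : ∀ v ∉ s, F v = v := fun v hv => Equiv.Perm.ofSubtype_apply_of_not_mem _ hv
  have hF3 : ∀ u ∈ s, ∀ v ∉ s, (cay S).Adj (F u) (F v) ↔ (cay S).Adj u v := by
    intro u hu v hv
    obtain ⟨k, hk⟩ := hf u
    rw [hF1 u hu, hF2 v hv, hk, htriv' k u hu v hv]
  refine ⟨F, ⟨fun u v => ?_, fun v => ?_⟩, hF1, hF2⟩
  · by_cases hu : u ∈ s <;> by_cases hv : v ∈ s
    · rw [hF1 u hu, hF1 v hv, hadj u hu v hv]
    · exact hF3 u hu v hv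
    · rw [hsymm, hF3 v hv u hu, hsymm]
    · rw [hF2 u hu, hF2 v hv]
  · by_cases hv : v ∈ s
    · obtain ⟨k, hk⟩ := hf v
      rw [hF1 v hv, hk]
      rfl
    · rw [hF2 v hv]

/-! ### Signs on the orbits of an element of order three -/

section signs

variable {S : Fin m → Fin m → Set G} {ρ : G} {h : Equiv.Perm (Fin m × G)}

theorem rightMul_rightMul_rightMul (hρ : ρ ^ 3 = 1) (v : Fin m × G) :
    rightMul m ρ (rightMul m ρ (rightMul m ρ v)) = v := by
  rw [rightMul_mul, rightMul_mul, ← mul_assoc, ← pow_two, ← pow_succ, hρ]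
  simp

theorem rightMul_inv_eq (hρ : ρ ^ 3 = 1) (v : Fin m × G) :
    rightMul m ρ⁻¹ v = rightMul m ρ (rightMul m ρ v) := by
  rw [rightMul_mul, inv_eq_of_mul_eq_one_left (a := ρ * ρ) (by rw [← hρ, pow_succ, pow_two])]

theorem rightMul_ne (hρ1 : ρ ≠ 1) (v : Fin m × G) : rightMul m ρ v ≠ v := by
  intro h
  exact hρ1 (by simpa using congrArg Prod.snd h)

/-- Where `h` agrees with `R(ρ)` is a union of orbits of `R(ρ)`. -/
theorem sign_rightMul_iff (hρ : ρ ^ 3 = 1) (hρ1 : ρ ≠ 1) (hh3 : ∀ v, h (h (h v)) = v)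
    (hh : ∀ v, h v = rightMul m ρ v ∨ h v = rightMul m ρ⁻¹ v) (v : Fin m × G) :
    h (rightMul m ρ v) = rightMul m ρ (rightMul m ρ v) ↔ h v = rightMul m ρ v := by
  have key : ∀ v, h v = rightMul m ρ v → h (rightMul m ρ v) = rightMul m ρ (rightMul m ρ v) := by
    intro v hv
    refine (hh _).resolve_right fun h1 => ?_
    have h2 := hh3 v
    rw [hv, h1, rightMul_mul, mul_inv_cancel] at h2
    have h3 : rightMul m (1 : G) v = v := by simp
    rw [h3, hv] at h2
    exact rightMul_ne hρ1 v h2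
  refine ⟨fun hv => ?_, key v⟩
  have h1 := key _ (key _ hv)
  rwa [rightMul_rightMul_rightMul hρ] at h1

theorem sign_pow_iff (hρ : ρ ^ 3 = 1) (hρ1 : ρ ≠ 1) (hh3 : ∀ v, h (h (h v)) = v)
    (hh : ∀ v, h v = rightMul m ρ v ∨ h v = rightMul m ρ⁻¹ v) (k : ℕ) (v : Fin m × G) :
    h (rightMul m (ρ ^ k) v) = rightMul m ρ (rightMul m (ρ ^ k) v) ↔ h v = rightMul m ρ v := by
  induction k with
  | zero => simp
  | succ k ih => rw [pow_succ, ← rightMul_mul, sign_rightMul_iff hρ hρ1 hh3 hh, ih]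

/-- Vertices of different signs are connected trivially. -/
theorem adj_rightMul_iff_of_sign (hρ : ρ ^ 3 = 1) (hρ1 : ρ ≠ 1) (hh3 : ∀ v, h (h (h v)) = v)
    (hh : ∀ v, h v = rightMul m ρ v ∨ h v = rightMul m ρ⁻¹ v) (haut : h ∈ blockAut (cay S))
    (u v : Fin m × G) (huv : ¬ (h u = rightMul m ρ u ↔ h v = rightMul m ρ v)) :
    (cay S).Adj u (rightMul m ρ v) ↔ (cay S).Adj u v := by
  have hsgn := sign_rightMul_iff hρ hρ1 hh3 hh
  -- Applying `h` and undoing the motion of `u` shifts `v` by `ρ⁻² = ρ` in the first case. In the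
  -- second it shifts `v` by `ρ ^ 2`, and two such shifts give `ρ ^ 4 = ρ`.
  by_cases hu : h u = rightMul m ρ u
  · have hv : h v = rightMul m ρ⁻¹ v := (hh v).resolve_left fun hv => huv (iff_of_true hu hv)
    rw [← haut.1 u v, hu, hv, rightMul_inv_eq hρ, cay_adj_rightMul]
  · have hv : h v = rightMul m ρ v := by
      by_contra hv
      exact huv (iff_of_false hu hv)
    have key : ∀ w, h w = rightMul m ρ w →
        ((cay S).Adj u w ↔ (cay S).Adj u (rightMul m ρ (rightMul m ρ w))) := by
      intro w hw
      rw [← haut.1 u w, hw, (hh u).resolve_left hu, ← cay_adj_rightMul S ρ, rightMul_mul ρ ρ⁻¹,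
        inv_mul_cancel]
      simp
    rw [key v hv, key _ ((hsgn _).2 ((hsgn _).2 hv)), rightMul_rightMul_rightMul hρ]

end signs

/-! ### Making the orbits equal and the signs constant -/

section reduction

variable {S : Fin m → Fin m → Set G} {ρ : G}

/-- The conjugate of `R(x)` by `σ`. -/
def conjMul (σ : Equiv.Perm (Fin m × G)) (x : G) : Equiv.Perm (Fin m × G) :=
  σ⁻¹ * rightMul m x * σ

theorem apply_conjMul (σ : Equiv.Perm (Fin m × G)) (x : G) (v : Fin m × G) :
    σ (conjMul σ x v) = rightMul m x (σ v) := by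
  simp [conjMul]

theorem conjMul_conjMul (σ : Equiv.Perm (Fin m × G)) (x y : G) (v : Fin m × G) :
    conjMul σ x (conjMul σ y v) = conjMul σ (y * x) v := by
  apply σ.injective
  rw [apply_conjMul, apply_conjMul, apply_conjMul, rightMul_mul]

theorem conjMul_mul (σ a : Equiv.Perm (Fin m × G)) (x : G) (v : Fin m × G) :
    a (conjMul (σ * a) x v) = conjMul σ x (a v) := by
  simp [conjMul]

theorem conjMul_ne (σ : Equiv.Perm (Fin m × G)) {x : G} (hx : x ≠ 1) (v : Fin m × G) :
    conjMul σ x v ≠ v := by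
  intro h
  have := apply_conjMul σ x v
  rw [h] at this
  exact rightMul_ne hx _ this.symm

theorem conjMul_conjMul_conjMul (hρ : ρ ^ 3 = 1) (σ : Equiv.Perm (Fin m × G)) (v : Fin m × G) :
    conjMul σ ρ (conjMul σ ρ (conjMul σ ρ v)) = v := by
  apply σ.injective
  rw [apply_conjMul, apply_conjMul, apply_conjMul, rightMul_rightMul_rightMul hρ]

/-- By Sylow's theorem, the conjugate of `R(ρ)` can be assumed to have the same orbits as
`R(ρ)`. -/
theorem exists_same_orbits [Finite G] (hG : Nat.card G < 9) (hρ : ρ ^ 3 = 1) (hρ1 : ρ ≠ 1)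
    {σ : Equiv.Perm (Fin m × G)} (hσ : ConjAut (cay S) σ) :
    ∃ a ∈ blockAut (cay S), ∀ v, conjMul (σ * a) ρ v = rightMul m ρ v ∨
      conjMul (σ * a) ρ v = rightMul m ρ⁻¹ v := by
  have : Fact (Nat.Prime 3) := ⟨Nat.prime_three⟩
  let r : blockAut (cay S) := ⟨rightMul m ρ, rightMul_mem_blockAut S ρ⟩
  let h : blockAut (cay S) := ⟨conjMul σ ρ, hσ ρ⟩
  have hr : r ^ 3 = 1 := by
    ext1
    ext1 v
    exact rightMul_rightMul_rightMul hρ v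
  have hh : h ^ 3 = 1 := by
    ext1
    ext1 v
    exact conjMul_conjMul_conjMul hρ σ v
  have hp : ∀ x : blockAut (cay S), x ^ 3 = 1 → IsPGroup 3 (Subgroup.zpowers x) := by
    intro x hx
    obtain ⟨k, -, hk⟩ := (Nat.dvd_prime_pow Nat.prime_three).1
      (show orderOf x ∣ 3 ^ 1 by simpa using orderOf_dvd_of_pow_eq_one hx)
    exact IsPGroup.of_card (n := k) (by rw [Nat.card_zpowers, hk])
  obtain ⟨P, hP⟩ := (hp r hr).exists_le_sylow
  obtain ⟨Q, hQ⟩ := (hp h hh).exists_le_sylow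
  obtain ⟨k, hk⟩ := MulAction.exists_smul_eq (blockAut (cay S)) Q P
  have hrP : r ∈ P := hP (Subgroup.mem_zpowers r)
  have hhP : k * h * k⁻¹ ∈ P := by
    rw [← hk]
    exact ⟨h, hQ (Subgroup.mem_zpowers h), rfl⟩
  refine ⟨(k⁻¹ : blockAut (cay S)), (k⁻¹).2, fun v => ?_⟩
  have hconj : conjMul (σ * ((k⁻¹ : blockAut (cay S)) : Equiv.Perm (Fin m × G))) ρ =
      ((k * h * k⁻¹ : blockAut (cay S)) : Equiv.Perm (Fin m × G)) := by
    simp [conjMul, h, mul_assoc]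
  have hne := conjMul_ne (σ * ((k⁻¹ : blockAut (cay S)) : Equiv.Perm (Fin m × G))) hρ1 v
  rw [hconj] at hne ⊢
  set c := k * h * k⁻¹ with hc
  -- Orbits of `P` have 3-power length and lie in a copy of size less than 9, so they are exactly
  -- the orbits of `R(ρ)`.
  obtain ⟨n, hn⟩ := P.isPGroup'.card_orbit (α := Fin m × G) v
  have hsub : MulAction.orbit P v ⊆ block G v.1 := by
    rintro _ ⟨x, rfl⟩
    exact x.1.2.2 v
  have hblock : (block G v.1).ncard = Nat.card G := by
    have : block G v.1 = (fun x => (v.1, x)) '' Set.univ := by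
      ext ⟨i, x⟩
      simp [block, eq_comm]
    rw [this, Set.ncard_image_of_injective _ (Prod.mk_right_injective _), Set.ncard_univ]
  have hle : (MulAction.orbit P v).ncard ≤ 3 := by
    have h1 := Set.ncard_le_ncard hsub (Set.toFinite _)
    rw [hblock] at h1
    have h2 : (MulAction.orbit P v).ncard = 3 ^ n := hn
    have hn2 : n < 2 := by
      by_contra! hn2
      have := Nat.pow_le_pow_right (show 0 < 3 by norm_num) hn2
      omega
    rw [h2]
    exact Nat.pow_le_pow_right (show 0 < 3 by norm_num) (show n ≤ 1 by omega)
  have hmem : ∀ x ∈ P, (x : Equiv.Perm (Fin m × G)) v ∈ MulAction.orbit P v :=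
    fun x hx => ⟨⟨x, hx⟩, rfl⟩
  have hsub3 : ({v, rightMul m ρ v, rightMul m ρ⁻¹ v} : Set (Fin m × G)) ⊆
      MulAction.orbit P v := by
    rintro w (rfl | rfl | rfl)
    · exact MulAction.mem_orbit_self _
    · exact hmem r hrP
    · rw [rightMul_inv_eq hρ]
      exact hmem (r * r) (mul_mem hrP hrP)
  have hcard3 : ({v, rightMul m ρ v, rightMul m ρ⁻¹ v} : Set (Fin m × G)).ncard = 3 := by
    refine Set.ncard_eq_three.2 ⟨_, _, _, (rightMul_ne hρ1 v).symm,
      (rightMul_ne (inv_ne_one.2 hρ1) v).symm, ?_, rfl⟩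
    rw [rightMul_inv_eq hρ]
    exact (rightMul_ne hρ1 _).symm
  have heq := Set.eq_of_subset_of_ncard_le hsub3 (by rw [hcard3]; exact hle) (Set.toFinite _)
  have hcv := hmem c hhP
  rw [← heq] at hcv
  rcases hcv with h1 | h1 | h1
  · exact absurd h1 hne
  · exact Or.inl h1
  · exact Or.inr h1

/-- For every set `A` of elements of `G`, the bipartite graph given by `A` has an automorphism
that fixes the left cosets of `ρ` and inverts `R(ρ)`. -/
def HasFlips (ρ : G) : Prop :=
  ∀ A : Set G, ∃ f f' : Equiv.Perm G, (∀ x y, y * x⁻¹ ∈ A ↔ f' y * (f x)⁻¹ ∈ A) ∧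
    (∀ x, f (x * ρ) = f x * ρ⁻¹) ∧ (∀ x, f' (x * ρ) = f' x * ρ⁻¹) ∧
    (∀ x, ∃ k : ℕ, f x = x * ρ ^ k) ∧ ∀ x, ∃ k : ℕ, f' x = x * ρ ^ k

/-- Two copies of a graph have a single connection set up to inversion, so `HasFlips` applies to it.
-/
theorem HasFlips.exists_family (hflip : HasFlips ρ) (hS : ∀ i, S i i = ∅) (hΓ : IsGraph (cay S))
    {B : Finset (Fin m)} (hB : B.card ≤ 2) :
    ∃ φ : Fin m → Equiv.Perm G,
      (∀ i ∈ B, ∀ j ∈ B, ∀ x y, y * x⁻¹ ∈ S i j ↔ φ j y * (φ i x)⁻¹ ∈ S i j) ∧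
      (∀ i x, φ i (x * ρ) = φ i x * ρ⁻¹) ∧ ∀ i x, ∃ k : ℕ, φ i x = x * ρ ^ k := by
  rcases hB.lt_or_eq with hB | hB
  · obtain ⟨f, -, -, hf, -, hf', -⟩ := hflip ∅
    refine ⟨fun _ => f, fun i hi j hj x y => ?_, fun _ => hf, fun _ => hf'⟩
    obtain rfl := Finset.card_le_one.1 (Nat.lt_succ_iff.1 hB) i hi j hj
    simp [hS]
  · obtain ⟨a, b, hab, rfl⟩ := Finset.card_eq_two.1 hB
    obtain ⟨f, f', hff', hf, hf2, hfk, hfk'⟩ := hflip (S a b)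
    refine ⟨fun i => if i = a then f else f', fun i hi j hj x y => ?_, fun i => ?_, fun i => ?_⟩
    · have hsymm : ∀ s, s ∈ S b a ↔ s⁻¹ ∈ S a b := by
        intro s
        have h1 : ∀ u v, (cay S).Adj u v ↔ (cay S).Adj v u := fun u v => ⟨hΓ u v, hΓ v u⟩
        have := h1 (b, 1) (a, s)
        simpa [cay_adj_iff] using this
      simp only [Finset.mem_insert, Finset.mem_singleton] at hi hj
      rcases hi with rfl | rfl <;> rcases hj with rfl | rfl
      · simp [hS]
      · simp only [if_neg hab.symm, if_true]
        exact hff' x y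
      · simp only [if_neg hab.symm, if_true, hsymm, mul_inv_rev, inv_inv]
        exact hff' y x
      · simp [hS]
    · dsimp only
      split_ifs
      · exact hf
      · exact hf2
    · dsimp only
      split_ifs
      · exact hfk
      · exact hfk'

/-- Connections leaving `B` are trivial, so a flip on `B` extends by the identity. It is used to
reverse the sign on the copies in `B`. -/
theorem exists_flip (hflip : HasFlips ρ) (hS : ∀ i, S i i = ∅) (hΓ : IsGraph (cay S))
    {B : Finset (Fin m)} (hB : B.card ≤ 2)
    (htriv : ∀ u v : Fin m × G, u.1 ∈ B → v.1 ∉ B →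
      ((cay S).Adj u (rightMul m ρ v) ↔ (cay S).Adj u v)) :
    ∃ F ∈ blockAut (cay S), (∀ v : Fin m × G, v.1 ∈ B →
      F (rightMul m ρ v) = rightMul m ρ⁻¹ (F v)) ∧ ∀ v : Fin m × G, v.1 ∉ B → F v = v := by
  obtain ⟨φ, hφ, hφρ, hφk⟩ := hflip.exists_family hS hΓ hB
  let f : Equiv.Perm (Fin m × G) := ⟨fun v => (v.1, φ v.1 v.2), fun v => (v.1, (φ v.1).symm v.2),
    fun v => by simp, fun v => by simp⟩
  have hf : ∀ v, f v = (v.1, φ v.1 v.2) := fun v => rfl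
  obtain ⟨F, hF, hF1, hF2⟩ := exists_restrict_mem_blockAut hΓ (ρ := ρ) (s := {v | v.1 ∈ B})
    (f := f) (fun v => Iff.rfl)
    (fun v => by
      obtain ⟨k, hk⟩ := hφk v.1 v.2
      exact ⟨k, by rw [hf, hk]; rfl⟩)
    (fun u hu v hv => by
      rw [cay_adj_iff, cay_adj_iff]
      exact (hφ _ hu _ hv _ _).symm)
    (fun u hu v hv => htriv u v hu hv)
  refine ⟨F, hF, fun v hv => ?_, hF2⟩
  rw [hF1 v hv, hF1 (rightMul m ρ v) hv, hf, hf]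
  exact Prod.ext rfl (hφρ _ _)

/-- If the signs are constant on the copies of `G`, then some automorphism makes them all equal. -/
theorem exists_sign_eq (hm : m ≤ 5) (hflip : HasFlips ρ) (hρ : ρ ^ 3 = 1) (hρ1 : ρ ≠ 1)
    (hS : ∀ i, S i i = ∅) (hΓ : IsGraph (cay S))
    {σ : Equiv.Perm (Fin m × G)} (hσ : ConjAut (cay S) σ)
    (hsgn : ∀ v, conjMul σ ρ v = rightMul m ρ v ∨ conjMul σ ρ v = rightMul m ρ⁻¹ v)
    (hconst : ∀ u v : Fin m × G, u.1 = v.1 → conjMul σ ρ u = rightMul m ρ u →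
      conjMul σ ρ v = rightMul m ρ v) :
    ∃ a ∈ blockAut (cay S), (∀ v, conjMul (σ * a) ρ v = rightMul m ρ v) ∨
      ∀ v, conjMul (σ * a) ρ v = rightMul m ρ⁻¹ v := by
  classical
  let B : Finset (Fin m) := Finset.univ.filter
    fun i => conjMul σ ρ (i, 1) = rightMul m ρ (i, (1 : G))
  have hBmem : ∀ v : Fin m × G, v.1 ∈ B ↔ conjMul σ ρ v = rightMul m ρ v := by
    intro v
    rw [Finset.mem_filter_univ]
    exact ⟨hconst (v.1, 1) v rfl, hconst v (v.1, 1) rfl⟩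
  have htriv : ∀ u v : Fin m × G, ¬ (u.1 ∈ B ↔ v.1 ∈ B) →
      ((cay S).Adj u (rightMul m ρ v) ↔ (cay S).Adj u v) := by
    intro u v huv
    rw [hBmem, hBmem] at huv
    exact adj_rightMul_iff_of_sign hρ hρ1 (conjMul_conjMul_conjMul hρ σ) hsgn (hσ ρ) u v huv
  have hinv : ∀ (F : Equiv.Perm (Fin m × G)) (v : Fin m × G),
      (∀ w : Fin m × G, w.1 = v.1 → F (rightMul m ρ w) = rightMul m ρ⁻¹ (F w)) →
      F (rightMul m ρ⁻¹ v) = rightMul m ρ (F v) := by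
    intro F v h
    have h1 := h (rightMul m ρ⁻¹ v) rfl
    rw [rightMul_mul, inv_mul_cancel] at h1
    have h2 : rightMul m (1 : G) v = v := by simp
    rw [h2] at h1
    rw [h1, rightMul_mul, inv_mul_cancel]
    simp
  -- Here `m ≤ 5` is decisive: of the two sign classes the smaller has at most two copies, and it is
  -- the one to be flipped.
  have hcards : B.card ≤ 2 ∨ Bᶜ.card ≤ 2 := by
    have := Finset.card_add_card_compl B
    rw [Fintype.card_fin] at this
    omega
  rcases hcards with hB | hB
  · obtain ⟨F, hF, hF1, hF2⟩ := exists_flip hflip hS hΓ hB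
      fun u v hu hv => htriv u v fun h => hv (h.1 hu)
    refine ⟨F, hF, Or.inr fun v => F.injective ?_⟩
    rw [conjMul_mul]
    by_cases hv : v.1 ∈ B
    · rw [(hBmem _).1 (by rwa [hF.2]), hinv F v fun w hw => hF1 w (hw ▸ hv)]
    · rw [hF2 v hv, hF2 _ (by exact hv)]
      exact (hsgn v).resolve_left fun h => hv ((hBmem v).2 h)
  · obtain ⟨F, hF, hF1, hF2⟩ := exists_flip hflip hS hΓ hB
      fun u v hu hv => htriv u v fun h => by
        rw [Finset.mem_compl] at hu hv
        exact hv fun h1 => hu (h.2 h1)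
    refine ⟨F, hF, Or.inl fun v => F.injective ?_⟩
    rw [conjMul_mul]
    by_cases hv : v.1 ∈ B
    · rw [hF2 v (by simpa using hv), hF2 _ (by simpa using hv)]
      exact (hBmem v).1 hv
    · rw [hF1 v (by simpa using hv)]
      exact (hsgn _).resolve_left fun h => hv (by rw [← hF.2]; exact (hBmem _).2 h)

end reduction

theorem mem_normalizer_of_forall_conjMul [Finite G] {n : Equiv.Perm (Fin m × G)}
    (hn : ∀ x : G, ∃ y : G, conjMul n x = rightMul m y) :
    n ∈ Subgroup.normalizer (rightMulGroup m G : Set (Equiv.Perm (Fin m × G))) := by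
  rw [← inv_mem_iff]
  refine mem_normalizer_of_forall fun x => ?_
  obtain ⟨y, hy⟩ := hn x
  exact ⟨y, by rw [← hy, conjMul, inv_inv]⟩

theorem exists_conjMul_eq_mul {n : Equiv.Perm (Fin m × G)} {x y : G}
    (hx : ∃ z : G, conjMul n x = rightMul m z) (hy : ∃ z : G, conjMul n y = rightMul m z) :
    ∃ z : G, conjMul n (x * y) = rightMul m z := by
  obtain ⟨a, ha⟩ := hx
  obtain ⟨b, hb⟩ := hy
  refine ⟨a * b, Equiv.ext fun v => ?_⟩
  rw [← conjMul_conjMul, ha, hb, rightMul_mul]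

theorem exists_conjMul_eq_pow {n : Equiv.Perm (Fin m × G)} {x : G}
    (hx : ∃ z : G, conjMul n x = rightMul m z) (k : ℕ) :
    ∃ z : G, conjMul n (x ^ k) = rightMul m z := by
  induction k with
  | zero => exact ⟨1, Equiv.ext fun v => by simp [conjMul]⟩
  | succ k ih => rw [pow_succ]; exact exists_conjMul_eq_mul ih hx

theorem exists_rightMul_eq {u v : Fin m × G} (h : u.1 = v.1) : ∃ g, v = rightMul m g u :=
  ⟨u.2⁻¹ * v.2, Prod.ext h.symm (by simp)⟩

/-- A cyclic group of order three is `m`PCI for `m ≤ 5`. -/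
theorem isPCIGroup_of_forall_eq_pow [Finite G] (hm : m ≤ 5) (hG : Nat.card G < 9) {ρ : G}
    (hρ : ρ ^ 3 = 1) (hρ1 : ρ ≠ 1) (hflip : HasFlips ρ) (hgen : ∀ g : G, ∃ k : ℕ, g = ρ ^ k) :
    IsPCIGroup m G := by
  rintro Γ ⟨⟨S, hS, rfl⟩, hΓ⟩
  refine isPCI_of_forall_conjAut fun σ _ hσ => ?_
  obtain ⟨a, ha, hsgn⟩ := exists_same_orbits hG hρ hρ1 hσ
  have hσa := hσ.mul ha
  obtain ⟨b, hb, hsgn'⟩ := exists_sign_eq hm hflip hρ hρ1 hS hΓ hσa hsgn fun u v huv hu => by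
    obtain ⟨g, rfl⟩ := exists_rightMul_eq huv
    obtain ⟨k, rfl⟩ := hgen g
    exact (sign_pow_iff hρ hρ1 (conjMul_conjMul_conjMul hρ _) hsgn k u).2 hu
  refine ⟨a * b, mul_mem ha hb, ?_⟩
  rw [← mul_assoc]
  refine mem_normalizer_of_forall_conjMul fun x => ?_
  obtain ⟨k, rfl⟩ := hgen x
  refine exists_conjMul_eq_pow ?_ k
  exact hsgn'.elim (fun h => ⟨_, Equiv.ext h⟩) fun h => ⟨_, Equiv.ext h⟩

/-! ### The dihedral group of order six -/

section dihedral

variable {S : Fin m → Fin m → Set G} {ρ τ : G}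

theorem pow_mul_eq_mul_pow (hρ : ρ ^ 3 = 1) (hτρ : ρ⁻¹ * τ = τ * ρ) (k : ℕ) :
    ρ ^ k * τ = τ * ρ ^ (2 * k) := by
  have h1 : ρ⁻¹ = ρ * ρ := inv_eq_of_mul_eq_one_left (by rw [← hρ, pow_succ, pow_two])
  have h2 : ρ * τ = τ * (ρ * ρ) := by
    have : ρ * (ρ⁻¹ * τ) * ρ⁻¹ = ρ * (τ * ρ) * ρ⁻¹ := by rw [hτρ]
    rw [mul_inv_cancel_left, mul_assoc, mul_assoc, mul_inv_cancel, mul_one, h1] at this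
    exact this.symm
  induction k with
  | zero => simp
  | succ k ih =>
    rw [pow_succ, mul_assoc, h2, ← mul_assoc, ih, mul_assoc, ← pow_two, ← pow_add, mul_add]

/-- If `R(ρ)` and its conjugate have the same orbits, then so do, up to exchanging the two orbits
of every copy of `G`, `R(τ)` and its conjugate. -/
theorem exists_conjMul_rightMul_eq (hρ : ρ ^ 3 = 1) (hρ1 : ρ ≠ 1) (hττ : τ * τ = 1)
    (hτρ : ρ⁻¹ * τ = τ * ρ) (hτ : ∀ k : ℕ, τ ≠ ρ ^ k)
    (hgen : ∀ g : G, ∃ k : ℕ, g = ρ ^ k ∨ g = ρ ^ k * τ)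
    {σ : Equiv.Perm (Fin m × G)} (hσ : ConjAut (cay S) σ)
    (hsgn : ∀ v, conjMul σ ρ v = rightMul m ρ v ∨ conjMul σ ρ v = rightMul m ρ⁻¹ v)
    (v : Fin m × G) : ∃ k : ℕ, conjMul σ τ (rightMul m τ v) = rightMul m (ρ ^ k) v := by
  have hpow : ∀ (w : Fin m × G) (k : ℕ), ∃ j : ℕ,
      rightMul m (ρ ^ k) w = conjMul σ (ρ ^ j) w := by
    intro w k
    induction k with
    | zero => exact ⟨0, by simp [conjMul]⟩
    | succ k ih =>
      obtain ⟨j, hj⟩ := ih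
      have hs := sign_rightMul_iff hρ hρ1 (conjMul_conjMul_conjMul hρ σ) hsgn
      set x := rightMul m (ρ ^ k) w with hx
      rw [pow_succ, ← rightMul_mul, ← hx]
      by_cases hxs : conjMul σ ρ x = rightMul m ρ x
      · exact ⟨j + 1, by rw [← hxs, hj, conjMul_conjMul, pow_succ]⟩
      · have h1 := (hsgn x).resolve_left hxs
        have h2 : conjMul σ ρ (rightMul m ρ⁻¹ x) = rightMul m ρ⁻¹ (rightMul m ρ⁻¹ x) := by
          refine (hsgn _).resolve_left fun h => hxs ?_
          rw [rightMul_inv_eq hρ, hs, hs] at h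
          exact h
        refine ⟨j + 1 + 1, ?_⟩
        rw [pow_succ, pow_succ, ← conjMul_conjMul, ← conjMul_conjMul, ← hj, h1, h2,
          rightMul_inv_eq hρ, rightMul_inv_eq hρ, rightMul_rightMul_rightMul hρ]
  obtain ⟨g, hg⟩ := exists_rightMul_eq ((hσ τ).2 (rightMul m τ v)).symm
  change conjMul σ τ (rightMul m τ v) = _ at hg
  obtain ⟨k, rfl | rfl⟩ := hgen g
  -- If the conjugate of `R(τ)` kept a point in its orbit, transport by `σ` would give `τ = ρ ^ j`.
  · obtain ⟨j, hj⟩ := hpow (rightMul m τ v) k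
    rw [hj] at hg
    have h1 := congrArg σ hg
    rw [apply_conjMul, apply_conjMul] at h1
    exact absurd (by simpa using congrArg Prod.snd h1) (hτ j)
  · refine ⟨2 * k, ?_⟩
    rw [hg, rightMul_mul, pow_mul_eq_mul_pow hρ hτρ, ← mul_assoc, hττ, one_mul]

/-- A copy consists of two orbits exchanged by `R(τ)`. Where their signs differ, the product of
`R(τ)` and its conjugate, restricted to the negative orbit, makes that orbit positive. -/
theorem exists_sign_const (hρ : ρ ^ 3 = 1) (hρ1 : ρ ≠ 1) (hττ : τ * τ = 1)
    (hτρ : ρ⁻¹ * τ = τ * ρ) (hτ : ∀ k : ℕ, τ ≠ ρ ^ k)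
    (hgen : ∀ g : G, ∃ k : ℕ, g = ρ ^ k ∨ g = ρ ^ k * τ) (hΓ : IsGraph (cay S))
    {σ : Equiv.Perm (Fin m × G)} (hσ : ConjAut (cay S) σ)
    (hsgn : ∀ v, conjMul σ ρ v = rightMul m ρ v ∨ conjMul σ ρ v = rightMul m ρ⁻¹ v) :
    ∃ a ∈ blockAut (cay S),
      (∀ v, conjMul (σ * a) ρ v = rightMul m ρ v ∨ conjMul (σ * a) ρ v = rightMul m ρ⁻¹ v) ∧
      ∀ u v : Fin m × G, u.1 = v.1 → conjMul (σ * a) ρ u = rightMul m ρ u →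
        conjMul (σ * a) ρ v = rightMul m ρ v := by
  have hs := sign_rightMul_iff hρ hρ1 (conjMul_conjMul_conjMul hρ σ) hsgn
  have hsk := sign_pow_iff hρ hρ1 (conjMul_conjMul_conjMul hρ σ) hsgn
  have htr : ∀ v : Fin m × G, rightMul m τ (rightMul m ρ v) =
      rightMul m ρ (rightMul m ρ (rightMul m τ v)) := by
    intro v
    have h1 := pow_mul_eq_mul_pow hρ hτρ 1
    rw [rightMul_mul, rightMul_mul, rightMul_mul, ← pow_two ρ]
    rw [pow_one, mul_one] at h1
    rw [h1]
  have hadj := adj_rightMul_iff_of_sign hρ hρ1 (conjMul_conjMul_conjMul hρ σ) hsgn (hσ ρ)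
  let s : Set (Fin m × G) := {v | conjMul σ ρ v ≠ rightMul m ρ v ∧
    conjMul σ ρ (rightMul m τ v) = rightMul m ρ (rightMul m τ v)}
  have hsr : ∀ v, rightMul m ρ v ∈ s ↔ v ∈ s := by
    intro v
    refine and_congr (hs v).not ?_
    rw [htr, hs, hs]
  have hfaut : conjMul σ τ * rightMul m τ ∈ blockAut (cay S) :=
    mul_mem (hσ τ) (rightMul_mem_blockAut S τ)
  obtain ⟨F, hF, hF1, hF2⟩ := exists_restrict_mem_blockAut hΓ hsr
    (f := conjMul σ τ * rightMul m τ)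
    (exists_conjMul_rightMul_eq hρ hρ1 hττ hτρ hτ hgen hσ hsgn)
    (fun u _ v _ => hfaut.1 u v) (by
      intro u hu v hv
      -- Either `v` has the opposite sign to `u`, or `R(τ)` takes the pair to one with opposite
      -- signs.
      by_cases hv1 : conjMul σ ρ v = rightMul m ρ v
      · exact hadj u v fun h => hu.1 (h.2 hv1)
      · have hv2 : conjMul σ ρ (rightMul m τ v) ≠ rightMul m ρ (rightMul m τ v) :=
          fun h => hv ⟨hv1, h⟩
        have h1 := hadj (rightMul m τ u) (rightMul m τ v) fun h => hv2 (h.1 hu.2)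
        have h2 := hadj (rightMul m τ u) (rightMul m ρ (rightMul m τ v))
          fun h => hv2 ((hs _).1 (h.1 hu.2))
        rw [← cay_adj_rightMul S τ, htr, h2, h1, cay_adj_rightMul])
  have hF3 : ∀ v ∈ s, conjMul (σ * F) ρ v = rightMul m ρ v := by
    intro v hv
    apply F.injective
    rw [conjMul_mul, hF1 v hv, hF1 _ ((hsr v).2 hv), Equiv.Perm.mul_apply, Equiv.Perm.mul_apply,
      htr, ← rightMul_inv_eq hρ]
    have h1 : conjMul σ ρ (rightMul m ρ⁻¹ (rightMul m τ v)) = rightMul m τ v := by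
      have h2 : conjMul σ ρ (rightMul m ρ⁻¹ (rightMul m τ v)) =
          rightMul m ρ (rightMul m ρ⁻¹ (rightMul m τ v)) := by
        rw [rightMul_inv_eq hρ, hs, hs]
        exact hv.2
      rw [h2, rightMul_mul, inv_mul_cancel]
      simp
    have h3 : rightMul m ρ⁻¹ (rightMul m τ v) = conjMul σ ρ⁻¹ (rightMul m τ v) := by
      conv_rhs => rw [← h1, conjMul_conjMul, mul_inv_cancel]
      simp [conjMul]
    rw [h3, conjMul_conjMul, conjMul_conjMul, hτρ]
  have hF4 : ∀ v ∉ s, conjMul (σ * F) ρ v = conjMul σ ρ v := by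
    intro v hv
    apply F.injective
    rw [conjMul_mul, hF2 v hv, hF2]
    rcases hsgn v with h | h <;> rw [h]
    · rwa [hsr]
    · rwa [rightMul_inv_eq hρ, hsr, hsr]
  have hF5 : ∀ v, conjMul (σ * F) ρ v = rightMul m ρ v ↔ (conjMul σ ρ v = rightMul m ρ v ∨
      conjMul σ ρ (rightMul m τ v) = rightMul m ρ (rightMul m τ v)) := by
    intro v
    by_cases hv : v ∈ s
    · exact iff_of_true (hF3 v hv) (Or.inr hv.2)
    · rw [hF4 v hv]
      refine ⟨Or.inl, fun h => ?_⟩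
      by_contra h1
      exact hv ⟨h1, h.resolve_left h1⟩
  refine ⟨F, hF, fun v => ?_, fun u v huv hu => ?_⟩
  · by_cases hv : v ∈ s
    · exact Or.inl (hF3 v hv)
    · rw [hF4 v hv]
      exact hsgn v
  · obtain ⟨g, rfl⟩ := exists_rightMul_eq huv
    rw [hF5] at hu ⊢
    obtain ⟨k, rfl | rfl⟩ := hgen g
    · rw [rightMul_mul τ, pow_mul_eq_mul_pow hρ hτρ, ← rightMul_mul _ τ, hsk, hsk]
      exact hu
    · rw [rightMul_mul τ, mul_assoc, hττ, mul_one, pow_mul_eq_mul_pow hρ hτρ, ← rightMul_mul _ τ,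
        hsk, hsk]
      exact hu.symm

/-- The dihedral group of order six is `m`PCI for `m ≤ 5`. -/
theorem isPCIGroup_of_dihedral [Finite G] (hm : m ≤ 5) (hG : Nat.card G < 9)
    (hρ : ρ ^ 3 = 1) (hρ1 : ρ ≠ 1) (hττ : τ * τ = 1)
    (hτρ : ρ⁻¹ * τ = τ * ρ) (hτ : ∀ k : ℕ, τ ≠ ρ ^ k) (hflip : HasFlips ρ)
    (hgen : ∀ g : G, ∃ k : ℕ, g = ρ ^ k ∨ g = ρ ^ k * τ) :
    IsPCIGroup m G := by
  rintro Γ ⟨⟨S, hS, rfl⟩, hΓ⟩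
  refine isPCI_of_forall_conjAut fun σ₀ _ hσ₀ => ?_
  obtain ⟨a, ha, hsgn⟩ := exists_same_orbits hG hρ hρ1 hσ₀
  obtain ⟨b, hb, hsgn', hconst⟩ := exists_sign_const hρ hρ1 hττ hτρ hτ hgen hΓ (hσ₀.mul ha) hsgn
  obtain ⟨c, hc, heq⟩ :=
    exists_sign_eq hm hflip hρ hρ1 hS hΓ ((hσ₀.mul ha).mul hb) hsgn' hconst
  have hσ := ((hσ₀.mul ha).mul hb).mul hc
  have habc : a * b * c ∈ blockAut (cay S) := mul_mem (mul_mem ha hb) hc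
  generalize hσdef : σ₀ * a * b * c = σ at heq hσ
  suffices h : ∃ d ∈ blockAut (cay S),
      σ * d ∈ Subgroup.normalizer (rightMulGroup m G : Set (Equiv.Perm (Fin m × G))) by
    obtain ⟨d, hd, h⟩ := h
    refine ⟨a * b * c * d, mul_mem habc hd, ?_⟩
    rwa [← hσdef, mul_assoc, mul_assoc, mul_assoc] at h
  have hsgnσ : ∀ v, conjMul σ ρ v = rightMul m ρ v ∨ conjMul σ ρ v = rightMul m ρ⁻¹ v :=
    fun v => heq.imp (fun h => h v) fun h => h v
  have horb := exists_conjMul_rightMul_eq hρ hρ1 hττ hτρ hτ hgen hσ hsgnσ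
  set r := rightMul m ρ with hr
  set t := rightMul m τ with ht
  set u := conjMul σ τ with hu
  have hrinv : rightMul m ρ⁻¹ = r⁻¹ := by
    refine eq_inv_of_mul_eq_one_left (Equiv.ext fun v => ?_)
    rw [Equiv.Perm.mul_apply, hr, rightMul_mul, mul_inv_cancel]
    simp
  have htt : t * t = 1 := Equiv.ext fun v => by
    rw [Equiv.Perm.mul_apply, ht, rightMul_mul, hττ]
    simp
  have huu : u * u = 1 := Equiv.ext fun v => by
    rw [Equiv.Perm.mul_apply, hu, conjMul_conjMul, hττ]
    simp [conjMul]
  have htr : t * r⁻¹ = r * t := Equiv.ext fun v => by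
    rw [← hrinv, Equiv.Perm.mul_apply, Equiv.Perm.mul_apply, hr, ht, rightMul_mul, rightMul_mul,
      hτρ]
  have huh : u * (conjMul σ ρ)⁻¹ = conjMul σ ρ * u := by
    have h1 : (conjMul σ ρ)⁻¹ = conjMul σ ρ⁻¹ := by
      refine (eq_inv_of_mul_eq_one_left (Equiv.ext fun v => ?_)).symm
      rw [Equiv.Perm.mul_apply, conjMul_conjMul, mul_inv_cancel]
      simp [conjMul]
    rw [h1]
    refine Equiv.ext fun v => ?_
    rw [Equiv.Perm.mul_apply, Equiv.Perm.mul_apply, hu, conjMul_conjMul, conjMul_conjMul, hτρ]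
  have hh : conjMul σ ρ = r ∨ conjMul σ ρ = r⁻¹ :=
    heq.imp (fun h => Equiv.ext h) fun h => hrinv ▸ Equiv.ext h
  have hur : u * r⁻¹ = r * u := by
    rcases hh with h | h <;> rw [h] at huh
    · exact huh
    · rw [inv_inv] at huh
      rw [mul_inv_eq_iff_eq_mul, mul_assoc, huh, mul_inv_cancel_left]
  have hutr : u * t * r = r * (u * t) := by
    have h1 : t * r = r⁻¹ * t := by
      rw [eq_inv_mul_iff_mul_eq, ← mul_assoc, ← htr, inv_mul_cancel_right]
    rw [mul_assoc, h1, ← mul_assoc, hur, mul_assoc]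
  -- At each vertex `u * t` acts as a power of `r`, with exponent depending on the vertex; since it
  -- commutes with `r`, its cube is trivial.
  have hut3 : u * t * (u * t) * (u * t) = 1 := by
    have hrk : ∀ k : ℕ, rightMul m (ρ ^ k) = r ^ k := by
      intro k
      induction k with
      | zero => exact Equiv.ext fun v => by simp
      | succ k ih =>
        rw [pow_succ', pow_succ, ← ih]
        exact Equiv.ext fun v => by rw [Equiv.Perm.mul_apply, rightMul_mul]
    have hr3 : r ^ 3 = 1 := by
      rw [← hrk, hρ]
      exact Equiv.ext fun v => by simp
    refine Equiv.ext fun v => ?_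
    obtain ⟨k, hk⟩ := horb v
    have hcomm : Commute (u * t) (r ^ k) := Commute.pow_right hutr k
    have h1 : (u * t) v = (r ^ k) v := by rw [← hrk]; exact hk
    have h2 : ∀ w, (u * t) ((r ^ k) w) = (r ^ k) ((u * t) w) := fun w =>
      congrArg (fun f : Equiv.Perm (Fin m × G) => f w) hcomm.eq
    rw [Equiv.Perm.mul_apply, Equiv.Perm.mul_apply, h1, h2, h1, h2, h2, h1,
      ← Equiv.Perm.mul_apply, ← Equiv.Perm.mul_apply, ← pow_add, ← pow_add,
      show k + k + k = 3 * k by ring, pow_mul, hr3, one_pow]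
  have hinv : (t * u)⁻¹ = u * t := inv_eq_of_mul_eq_one_left (by
    rw [mul_assoc, ← mul_assoc t, htt, one_mul, huu])
  -- Conjugation by `t * u` fixes the conjugate of `R(ρ)`, and `(u * t) ^ 3 = 1` makes it take `u`
  -- to `t`: two involutions in a dihedral group of order dividing 6.
  refine ⟨t * u, mul_mem (rightMul_mem_blockAut S τ) (hσ τ), ?_⟩
  have hconj : ∀ x, conjMul (σ * (t * u)) x = (t * u)⁻¹ * conjMul σ x * (t * u) := by
    intro x
    simp only [conjMul]
    group
  have hgρ : ∃ z, conjMul (σ * (t * u)) ρ = rightMul m z := by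
    have hcomm : Commute (u * t) (conjMul σ ρ) := by
      rcases hh with h | h <;> rw [h]
      · exact hutr
      · exact Commute.inv_right hutr
    rw [hconj, hinv, hcomm.eq, ← hinv, inv_mul_cancel_right]
    exact hh.elim (fun h => ⟨ρ, h⟩) fun h => ⟨ρ⁻¹, h.trans hrinv.symm⟩
  have hgτ : ∃ z, conjMul (σ * (t * u)) τ = rightMul m z := by
    refine ⟨τ, ?_⟩
    rw [hconj, hinv]
    change u * t * u * (t * u) = t
    have h1 : u * t * u * (t * u) * t = 1 := by
      rw [← hut3]
      simp only [mul_assoc]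
    rw [eq_inv_of_mul_eq_one_left h1, inv_eq_of_mul_eq_one_left htt]
  refine mem_normalizer_of_forall_conjMul fun x => ?_
  obtain ⟨k, rfl | rfl⟩ := hgen x
  · exact exists_conjMul_eq_pow hgρ k
  · exact exists_conjMul_eq_mul (exists_conjMul_eq_pow hgρ k) hgτ

end dihedral

/-! ### Flips in groups of order three and six -/

theorem HasFlips.of_mulEquiv {H : Type*} [Group H] (e : G ≃* H) {ρ : H} (h : HasFlips ρ) :
    HasFlips (e.symm ρ) := by
  intro A
  obtain ⟨f, f', hff', hf, hf', hk, hk'⟩ := h (e '' A)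
  have hA : ∀ z : H, z ∈ e '' A ↔ e.symm z ∈ A := fun z =>
    ⟨by rintro ⟨a, ha, rfl⟩; simpa using ha, fun h => ⟨_, h, by simp⟩⟩
  refine ⟨(e.toEquiv.trans f).trans e.symm.toEquiv, (e.toEquiv.trans f').trans e.symm.toEquiv,
    fun x y => ?_, fun x => ?_, fun x => ?_, fun x => ?_, fun x => ?_⟩
  · have := hff' (e x) (e y)
    rw [hA, hA] at this
    simpa using this
  · simp [hf]
  · simp [hf']
  · obtain ⟨k, hk⟩ := hk (e x)
    exact ⟨k, by simp [hk]⟩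
  · obtain ⟨k, hk⟩ := hk' (e x)
    exact ⟨k, by simp [hk]⟩

/-- Two of the three elements agree on membership in `A`; the reflection exchanging them fixes the
third. -/
theorem exists_forall_mem_iff_sub_mem (A : Set (ZMod 3)) : ∃ c, ∀ k, k ∈ A ↔ c - k ∈ A := by
  have key : ∀ c : ZMod 3, (0 ∈ A ↔ c - 0 ∈ A) → (1 ∈ A ↔ c - 1 ∈ A) → (2 ∈ A ↔ c - 2 ∈ A) →
      ∀ k, k ∈ A ↔ c - k ∈ A := by
    intro c h0 h1 h2 k
    fin_cases k
    · exact h0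
    · exact h1
    · exact h2
  have h : (0 ∈ A ↔ 1 ∈ A) ∨ (0 ∈ A ↔ 2 ∈ A) ∨ (1 ∈ A ↔ 2 ∈ A) := by tauto
  rcases h with h | h | h
  · exact ⟨1, key 1 h h.symm Iff.rfl⟩
  · exact ⟨2, key 2 h Iff.rfl h.symm⟩
  · exact ⟨0, key 0 Iff.rfl h h.symm⟩

theorem hasFlips_zmod_three : HasFlips (Multiplicative.ofAdd (1 : ZMod 3)) := by
  intro A
  obtain ⟨c, hc⟩ := exists_forall_mem_iff_sub_mem (Multiplicative.ofAdd ⁻¹' A)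
  have hpow : ∀ x y : Multiplicative (ZMod 3), ∃ k : ℕ, y = x * Multiplicative.ofAdd 1 ^ k := by
    intro x y
    obtain ⟨k, hk⟩ : ∃ k : Fin 3, y = x * Multiplicative.ofAdd 1 ^ k.1 := by
      revert x y
      decide
    exact ⟨k, hk⟩
  refine ⟨Equiv.inv _, (Equiv.inv _).trans (Equiv.mulLeft (Multiplicative.ofAdd c)),
    fun x y => ?_, fun x => ?_, fun x => ?_, fun x => hpow _ _, fun x => hpow _ _⟩
  · have h : Multiplicative.ofAdd c * y⁻¹ * x⁻¹⁻¹ =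
        Multiplicative.ofAdd (c - (y * x⁻¹).toAdd) := by
      rw [mul_assoc, ← mul_inv, ← div_eq_mul_inv]
      rfl
    change _ ↔ Multiplicative.ofAdd c * y⁻¹ * x⁻¹⁻¹ ∈ A
    rw [h]
    exact hc (y * x⁻¹).toAdd
  · exact mul_inv _ _
  · change Multiplicative.ofAdd c * (x * _)⁻¹ = Multiplicative.ofAdd c * x⁻¹ * _
    rw [mul_inv, mul_assoc]

open DihedralGroup in
-- Rotations and reflections in `A` each have a reflection symmetry, with centres `c` and `d`. The
-- maps `x ↦ sr a * x * sr 0` have one free parameter for each of the two copies, enough to realize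
-- both symmetries at once.
theorem hasFlips_dihedralGroup_three : HasFlips (r 1 : DihedralGroup 3) := by
  intro A
  obtain ⟨c, hc⟩ := exists_forall_mem_iff_sub_mem {k | r k ∈ A}
  obtain ⟨d, hd⟩ := exists_forall_mem_iff_sub_mem {k | sr k ∈ A}
  have hinv : ∀ (a : ZMod 3) (x : DihedralGroup 3), sr a * (sr a * x * sr 0) * sr 0 = x := by
    intro a x
    rw [mul_assoc (sr a) x, ← mul_assoc (sr a) (sr a), sr_mul_self, one_mul, mul_assoc,
      sr_mul_self, mul_one]
  let f : ZMod 3 → Equiv.Perm (DihedralGroup 3) := fun a =>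
    ⟨fun x => sr a * x * sr 0, fun x => sr a * x * sr 0, hinv a, hinv a⟩
  have hf : ∀ a x, f a x = sr a * x * sr 0 := fun _ _ => rfl
  have hfρ : ∀ a x, f a (x * r 1) = f a x * (r 1)⁻¹ := by
    intro a x
    simp only [hf, inv_r, mul_assoc, r_mul_sr, sr_mul_r]
    simp
  have hfk : ∀ a x, ∃ k : ℕ, f a x = x * r 1 ^ k := by
    intro a x
    rcases x with i | i
    · refine ⟨(-a - 2 * i).val, ?_⟩
      rw [hf, r_one_pow, ZMod.natCast_zmod_val, sr_mul_r, sr_mul_sr, r_mul_r]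
      congr 1
      ring
    · refine ⟨(a - 2 * i).val, ?_⟩
      rw [hf, r_one_pow, ZMod.natCast_zmod_val, sr_mul_r, sr_mul_sr, r_mul_sr]
      congr 1
      ring
  have h3 : (3 : ZMod 3) = 0 := by decide
  -- Parameters `p` for `f` and `q` for `f'` send `r k` to `r (p - q - k)` and `sr k` to `sr (p + q
  -- - k)`. These values solve `p - q = c` and `p + q = d` modulo 3.
  refine ⟨f (-(c + d)), f (c - d), fun x y => ?_, hfρ _, hfρ _, hfk _, hfk _⟩
  have h1 : f (c - d) y * (f (-(c + d)) x)⁻¹ = sr (c - d) * (y * x⁻¹) * sr (-(c + d)) := by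
    rw [hf, hf, mul_inv_rev, mul_inv_rev, inv_sr, inv_sr, mul_assoc _ (sr 0),
      ← mul_assoc (sr 0) (sr 0), sr_mul_self, one_mul]
    simp only [mul_assoc]
  rw [h1]
  generalize y * x⁻¹ = z
  rcases z with k | k
  · rw [sr_mul_r, sr_mul_sr]
    refine (hc k).trans (iff_of_eq (congrArg (fun i => r i ∈ A) ?_))
    linear_combination c * h3
  · rw [sr_mul_sr, r_mul_sr]
    refine (hd k).trans (iff_of_eq (congrArg (fun i => sr i ∈ A) ?_))
    linear_combination d * h3

theorem isPCIGroup_of_mulEquiv_zmod_three [Finite G] (hm : m ≤ 5)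
    (e : G ≃* Multiplicative (ZMod 3)) : IsPCIGroup m G := by
  refine isPCIGroup_of_forall_eq_pow hm ?_ (ρ := e.symm (Multiplicative.ofAdd 1)) ?_ ?_
    (hasFlips_zmod_three.of_mulEquiv e) ?_
  · rw [Nat.card_congr e.toEquiv]
    simp
  · rw [← map_pow, e.symm.map_eq_one_iff]
    decide
  · rw [Ne, e.symm.map_eq_one_iff]
    decide
  · intro g
    have : ∀ x : Multiplicative (ZMod 3), ∃ k : Fin 3, x = Multiplicative.ofAdd 1 ^ k.1 := by
      decide
    obtain ⟨k, hk⟩ := this (e g)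
    exact ⟨k, by rw [← map_pow, ← hk, e.symm_apply_apply]⟩

open DihedralGroup in
theorem isPCIGroup_of_mulEquiv_dihedralGroup_three [Finite G] (hm : m ≤ 5)
    (e : G ≃* DihedralGroup 3) : IsPCIGroup m G := by
  refine isPCIGroup_of_dihedral hm ?_ (ρ := e.symm (r 1)) (τ := e.symm (sr 0)) ?_ ?_ ?_ ?_ ?_
    (hasFlips_dihedralGroup_three.of_mulEquiv e) ?_
  · rw [Nat.card_congr e.toEquiv, DihedralGroup.nat_card]
    norm_num
  · rw [← map_pow, e.symm.map_eq_one_iff]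
    decide
  · rw [Ne, e.symm.map_eq_one_iff]
    decide
  · rw [← map_mul, e.symm.map_eq_one_iff]
    decide
  · rw [← map_inv, ← map_mul, ← map_mul, e.symm.injective.eq_iff]
    decide
  · intro k
    rw [← map_pow, e.symm.injective.ne_iff, r_one_pow]
    exact fun h => by cases h
  · intro g
    obtain ⟨x, rfl⟩ := e.symm.surjective g
    simp only [← map_pow, ← map_mul, e.symm.injective.eq_iff, r_one_pow]
    rcases x with i | i
    · exact ⟨i.val, Or.inl (by rw [ZMod.natCast_zmod_val])⟩
    · exact ⟨(-i).val, Or.inr (by rw [ZMod.natCast_zmod_val, r_mul_sr, sub_neg_eq_add, zero_add])⟩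

/-! ### Groups of order at most two -/

/-- For `x ≠ 1`, both `R(x)` and its conjugate preserve each copy without fixed points; on at most
two points this determines them, so `σ` itself normalizes `R(G)`. -/
theorem isPDCIGroup_of_card_le_two [Finite G] (hG : Nat.card G ≤ 2) : IsPDCIGroup m G := by
  rintro Γ ⟨S, -, rfl⟩
  refine isPCI_of_forall_conjAut fun σ hσ _ => ⟨1, one_mem _, ?_⟩
  refine mem_normalizer_of_forall_conjMul fun x => ⟨x, Equiv.ext fun v => ?_⟩
  rw [mul_one]
  have hfst : (conjMul σ x v).1 = (rightMul m x v).1 := by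
    change _ = v.1
    rw [← hσ, apply_conjMul]
    rfl
  by_cases hx : x = 1
  · simp [hx, conjMul]
  refine Prod.ext hfst ?_
  by_contra hne
  have h1 : (conjMul σ x v).2 ≠ v.2 := fun h => conjMul_ne σ hx v (Prod.ext hfst h)
  have h2 : (rightMul m x v).2 ≠ v.2 := fun h => rightMul_ne hx v (Prod.ext rfl h)
  have h3 : ({v.2, (conjMul σ x v).2, (rightMul m x v).2} : Set G).ncard = 3 :=
    Set.ncard_eq_three.2 ⟨_, _, _, h1.symm, h2.symm, hne, rfl⟩
  have h4 := Set.ncard_le_card ({v.2, (conjMul σ x v).2, (rightMul m x v).2} : Set G)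
  omega

theorem isPDCIGroup_of_mulEquiv_zmod_one [Finite G] (e : G ≃* Multiplicative (ZMod 1)) :
    IsPDCIGroup m G :=
  isPDCIGroup_of_card_le_two (by rw [Nat.card_congr e.toEquiv]; simp)

theorem isPDCIGroup_of_mulEquiv_zmod_two [Finite G] (e : G ≃* Multiplicative (ZMod 2)) :
    IsPDCIGroup m G :=
  isPDCIGroup_of_card_le_two (by rw [Nat.card_congr e.toEquiv]; simp)

end MCayley

theorem mainTheorem1 (m : ℕ) (hm : 4 ≤ m) (G : Type*) [Group G] [Finite G] :
    (MCayley.IsPCIGroup m G ↔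
      Nonempty (G ≃* Multiplicative (ZMod 1)) ∨ Nonempty (G ≃* Multiplicative (ZMod 2)) ∨
        ((Nonempty (G ≃* Multiplicative (ZMod 3)) ∨ Nonempty (G ≃* DihedralGroup 3)) ∧
          (m = 4 ∨ m = 5))) ∧
    (MCayley.IsPDCIGroup m G ↔
      Nonempty (G ≃* Multiplicative (ZMod 1)) ∨ Nonempty (G ≃* Multiplicative (ZMod 2))) := by
  refine ⟨⟨fun h => ?_, ?_⟩, fun h => ?_, ?_⟩
  · rcases MCayley.mulEquiv_of_isPCIGroup hm h with h1 | h2 | h3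
    · exact Or.inl h1
    · exact Or.inr (Or.inl h2)
    · refine Or.inr (Or.inr ⟨h3, ?_⟩)
      obtain ⟨g, hg⟩ := MCayley.exists_orderOf_eq_three h3
      by_contra hm'
      exact MCayley.not_isPCIGroup_of_orderOf_eq_three (by omega) hg h
  · rintro (⟨⟨e⟩⟩ | ⟨⟨e⟩⟩ | ⟨⟨⟨e⟩⟩ | ⟨⟨e⟩⟩, hm'⟩)
    · exact (MCayley.isPDCIGroup_of_mulEquiv_zmod_one e).isPCIGroup
    · exact (MCayley.isPDCIGroup_of_mulEquiv_zmod_two e).isPCIGroup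
    · exact MCayley.isPCIGroup_of_mulEquiv_zmod_three (by omega) e
    · exact MCayley.isPCIGroup_of_mulEquiv_dihedralGroup_three (by omega) e
  · rcases MCayley.mulEquiv_of_isPCIGroup hm h.isPCIGroup with h1 | h2 | h3
    · exact Or.inl h1
    · exact Or.inr h2
    · obtain ⟨g, hg⟩ := MCayley.exists_orderOf_eq_three h3
      exact absurd h (MCayley.not_isPDCIGroup_of_orderOf_eq_three hm hg)
  · rintro (⟨⟨e⟩⟩ | ⟨⟨e⟩⟩)
    · exact MCayley.isPDCIGroup_of_mulEquiv_zmod_one e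
    · exact MCayley.isPDCIGroup_of_mulEquiv_zmod_two e
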